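/- Conventions. A \emph{real algebraic variety} $X$ is a set of real points covered by finitely many charts, each of which identifies a subset of $X$ with a Zariski closed subset of some $\mathbb{R}^n$, such that the overlaps are Zariski open and the transition maps are regular; for example, $X$ may be the common zero set in $\mathbb{R}^n$ of a family of polynomials. Thus $X$ carries a Zariski topology and a Euclidean topology. A \emph{subvariety} is a Zariski locally closed subset (for example a Zariski closed one). A real-valued function $\varphi$ on a subset $S\subset X$ is \emph{regular} if every $x\in S$ has a Zariski neighborhood in $S$ on which, in a chart, $\varphi=p/q$ with polynomials $p,q$ such that $q(x)\neq 0$. The \emph{singular locus} of $X$ is the set of points $x$ at which the local ring $\mathcal{O}_{X,x}$ (in a chart with model $V\subset\mathbb{R}^n$, the localization at $x$ of $\mathbb{R}[x_1,\dots,x_n]/I(V)$, where $I(V)$ is the ideal of all polynomials vanishing on $V$) is not a regular local ring; $X$ is \emph{smooth} if its singular locus is empty. A \emph{rational function} $f$ on $X$ is an equivalence class of regular functions on Zariski dense open subsets of $X$, two of them being equivalent if they agree on a Zariski dense open subset of the intersection of their domains; $f$ is \emph{defined} at $x$ if some representative has $x$ in its domain. A \emph{continuous extension} of $f$ is a function $f^c:X\to\mathbb{R}$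 that is continuous in the Euclidean topology and agrees with $f$ at all points where $f$ is defined. A function $h:X\to\mathbb{R}$, continuous in the Euclidean topology, is \emph{hereditarily rational} if every irreducible subvariety $Z\subset X$ has a Zariski dense, Zariski open subset $Z^0\subset Z$ such that $h|_{Z^0}$ is regular on $Z^0$. Proposition. Let $X$ be a real algebraic variety. (1) Let $Z\subset X$ be an irreducible subvariety that is not contained in the singular locus of $X$, and let $f$ be a rational function on $X$ with a continuous extension $f^c$. Then there is a Zariski dense, Zariski open subset $Z^0\subset Z$ such that $f^c|_{Z^0}$ is a regular function on $Z^0$. (2) Consequently, if $X$ is smooth, then every continuous rational function on $X$ is hereditarily rational: if $f$ is a rational function on $X$ with a continuous extension $f^c$, then $f^c$ is hereditarily rational. -/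

import Mathlib

open Topology

noncomputable section

/-! ### Affine pieces: Zariski closed subsets of `ℝⁿ` -/

/-- The Zariski topology on `ℝⁿ`: the closed sets are the common zero loci of sets (equivalently,
ideals) of real polynomials. -/
abbrev realZariski (n : ℕ) : TopologicalSpace (Fin n → ℝ) :=
  TopologicalSpace.ofClosed
    {A | ∃ I : Ideal (MvPolynomial (Fin n) ℝ), A = MvPolynomial.zeroLocus ℝ I}
    ⟨⊤, MvPolynomial.zeroLocus_top.symm⟩
    (by
      intro T hT
      refine ⟨sSup {I | MvPolynomial.zeroLocus ℝ I ∈ T}, ?_⟩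
      ext x
      simp only [Set.mem_sInter]
      constructor
      · intro h
        have hle : sSup {I : Ideal (MvPolynomial (Fin n) ℝ) | MvPolynomial.zeroLocus ℝ I ∈ T} ≤
            MvPolynomial.vanishingIdeal ℝ {x} := by
          refine sSup_le fun I hI p hp => ?_
          rw [MvPolynomial.mem_vanishingIdeal_singleton_iff]
          exact h _ hI p hp
        intro p hp
        exact (MvPolynomial.mem_vanishingIdeal_singleton_iff x p).1 (hle hp)
      · intro h A hA
        obtain ⟨I, rfl⟩ := hT hA
        exact MvPolynomial.zeroLocus_anti_mono (le_sSup hA) h)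
    (by
      rintro _ ⟨I, rfl⟩ _ ⟨J, rfl⟩
      refine ⟨I * J, ?_⟩
      ext x
      constructor
      · rintro (h | h)
        · exact MvPolynomial.zeroLocus_anti_mono Ideal.mul_le_left h
        · exact MvPolynomial.zeroLocus_anti_mono Ideal.mul_le_right h
      · intro h
        by_contra hcon
        simp only [Set.mem_union, MvPolynomial.mem_zeroLocus_iff, not_or, not_forall] at hcon
        obtain ⟨⟨p, hp, hpx⟩, ⟨q, hq, hqx⟩⟩ := hcon
        have := h (p * q) (Ideal.mul_mem_mul hp hq)
        rw [map_mul] at this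
        exact (mul_ne_zero hpx hqx) this)

/-- The ring `ℝ[V] = ℝ[x₁, …, xₙ] / I(V)` of polynomial functions on `V ⊆ ℝⁿ`, where `I(V)` is the
ideal of all real polynomials vanishing on `V`. -/
abbrev CoordRing {n : ℕ} (V : Set (Fin n → ℝ)) : Type :=
  MvPolynomial (Fin n) ℝ ⧸ MvPolynomial.vanishingIdeal ℝ V

/-- Evaluation `ℝ[V] → ℝ` at a point of `V`. -/
def CoordRing.evalAt {n : ℕ} {V : Set (Fin n → ℝ)} (v : V) : CoordRing V →+* ℝ :=
  Ideal.Quotient.lift (MvPolynomial.vanishingIdeal ℝ V)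
    (MvPolynomial.eval (v : Fin n → ℝ)) (fun p hp => by
      have := hp v.1 v.2
      rwa [MvPolynomial.aeval_eq_eval] at this)

instance CoordRing.ker_evalAt_isPrime {n : ℕ} {V : Set (Fin n → ℝ)} (v : V) :
    (RingHom.ker (CoordRing.evalAt v)).IsPrime :=
  RingHom.ker_isPrime _

/-- The local ring of `V` at `v`: the localization of `ℝ[V]` at the maximal ideal of `v`. -/
abbrev AffineLocalRing {n : ℕ} {V : Set (Fin n → ℝ)} (v : V) : Type :=
  Localization.AtPrime (RingHom.ker (CoordRing.evalAt v))

/-! ### Real algebraic varieties -/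

/-- A real algebraic variety: a set of (real) points covered by finitely many charts
`chart i : model i → X`, injective parametrizations by Zariski closed subsets
`model i ⊆ ℝ^(dim i)`, such that the overlaps are Zariski open in the models and the transition
maps are regular, i.e. their coordinates are locally quotients of polynomials. -/
structure RealAlgebraicVariety where
  /-- the set of points -/
  carrier : Type*
  /-- the number of charts -/
  numCharts : ℕ
  /-- the dimension of the affine space containing the `i`-th model -/
  dim : Fin numCharts → ℕ
  /-- the `i`-th model -/
  model : ∀ i, Set (Fin (dim i) → ℝ)
  /-- the `i`-th chart -/
  chart : ∀ i, model i → carrier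
  model_closed : ∀ i, IsClosed[realZariski (dim i)] (model i)
  chart_injective : ∀ i, Function.Injective (chart i)
  chart_cover : ∀ x, ∃ i v, chart i v = x
  overlap_open : ∀ i j, ∃ O : Set (Fin (dim i) → ℝ), IsOpen[realZariski (dim i)] O ∧
    ∀ v : model i, chart i v ∈ Set.range (chart j) ↔ (v : Fin (dim i) → ℝ) ∈ O
  transition_regular : ∀ (i j) (v : model i) (w : model j), chart i v = chart j w →
    ∀ k : Fin (dim j), ∃ p q : MvPolynomial (Fin (dim i)) ℝ, q.eval v.1 ≠ 0 ∧
      ∀ (v' : model i) (w' : model j), chart i v' = chart j w' → q.eval v'.1 ≠ 0 →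
        w'.1 k = p.eval v'.1 / q.eval v'.1

namespace RealAlgebraicVariety

/-- The Zariski topology of `X`: a set is open iff its preimage in every chart is relatively
Zariski open in the model. -/
abbrev zariski (X : RealAlgebraicVariety) : TopologicalSpace X.carrier :=
  ⨆ i, TopologicalSpace.coinduced (X.chart i)
    (TopologicalSpace.induced Subtype.val (realZariski (X.dim i)))

/-- The Euclidean topology of `X`: a set is open iff its preimage in every chart is relatively
open in the model for the usual topology of `ℝⁿ`. -/
abbrev euclidean (X : RealAlgebraicVariety) : TopologicalSpace X.carrier :=
  ⨆ i, TopologicalSpace.coinduced (X.chart i) instTopologicalSpaceSubtype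

/-- `φ|_S` is regular at `x`: on a Zariski neighbourhood of `x` in `S` it is, in some chart, a
quotient of two polynomials whose denominator does not vanish at `x`. -/
def IsRegularAt (X : RealAlgebraicVariety) (φ : X.carrier → ℝ) (S : Set X.carrier)
    (x : X.carrier) : Prop :=
  ∃ (i : Fin X.numCharts) (v : X.model i), X.chart i v = x ∧
    ∃ p q : MvPolynomial (Fin (X.dim i)) ℝ, q.eval v.1 ≠ 0 ∧
      ∀ w : X.model i, X.chart i w ∈ S → q.eval w.1 ≠ 0 →
        φ (X.chart i w) = p.eval w.1 / q.eval w.1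

/-- The restriction of `φ` to `S` is a regular function on `S`. -/
def IsRegularOn (X : RealAlgebraicVariety) (φ : X.carrier → ℝ) (S : Set X.carrier) : Prop :=
  ∀ x ∈ S, X.IsRegularAt φ S x

/-- The singular locus of `X`: the points whose local ring is not a regular local ring. -/
def singularLocus (X : RealAlgebraicVariety) : Set X.carrier :=
  {x | ¬ ∃ (i : Fin X.numCharts) (v : X.model i), X.chart i v = x ∧
    IsRegularLocalRing (AffineLocalRing v)}

/-- `X` is smooth. -/
def IsSmooth (X : RealAlgebraicVariety) : Prop := X.singularLocus = ∅

/-- An irreducible subvariety of `X`: a Zariski locally closed (for example a Zariski closed)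
subset that is irreducible, hence nonempty. -/
def IsIrreducibleSubvariety (X : RealAlgebraicVariety) (Z : Set X.carrier) : Prop :=
  @IsLocallyClosed _ X.zariski Z ∧ @IsIrreducible _ X.zariski Z

/-- `Z₀` is a Zariski open and Zariski dense subset of the subset `Z` of `X`. -/
def IsDenseOpenIn (X : RealAlgebraicVariety) (Z₀ Z : Set X.carrier) : Prop :=
  (∃ O, IsOpen[X.zariski] O ∧ Z₀ = Z ∩ O) ∧ Z ⊆ closure[X.zariski] Z₀

/-! ### Rational functions -/

/-- A regular function on a Zariski dense open subset of `X` (the values of `toFun` outside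
`domain` are irrelevant). -/
structure PartialRegular (X : RealAlgebraicVariety) where
  domain : Set X.carrier
  toFun : X.carrier → ℝ
  isOpen_domain : IsOpen[X.zariski] domain
  dense_domain : @Dense _ X.zariski domain
  regular : X.IsRegularOn toFun domain

/-- Two such functions are equivalent if they agree on a Zariski dense open subset of the
intersection of their domains. -/
def PartialRegular.setoid (X : RealAlgebraicVariety) : Setoid X.PartialRegular where
  r a b := ∃ W : Set X.carrier, IsOpen[X.zariski] W ∧ @Dense _ X.zariski W ∧
    W ⊆ a.domain ∩ b.domain ∧ ∀ x ∈ W, a.toFun x = b.toFun x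
  iseqv :=
    { refl := fun a => ⟨a.domain, a.isOpen_domain, a.dense_domain, fun _ hx => ⟨hx, hx⟩,
        fun _ _ => rfl⟩
      symm := fun ⟨W, hW, hd, hs, he⟩ =>
        ⟨W, hW, hd, fun _ hx => ⟨(hs hx).2, (hs hx).1⟩, fun x hx => (he x hx).symm⟩
      trans := fun ⟨W, hW, hd, hs, he⟩ ⟨W', hW', hd', hs', he'⟩ =>
        ⟨W ∩ W', X.zariski.isOpen_inter _ _ hW hW',
          @Dense.inter_of_isOpen_left _ X.zariski _ _ hd hd' hW,
          fun _ hx => ⟨(hs hx.1).1, (hs' hx.2).2⟩,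
          fun x hx => (he x hx.1).trans (he' x hx.2)⟩ }

/-- A rational function on `X`: an equivalence class of regular functions on Zariski dense open
subsets of `X`. -/
def RationalFunction (X : RealAlgebraicVariety) : Type _ := Quotient (PartialRegular.setoid X)

/-- `g` is a continuous extension of the rational function `f`: it is continuous on all of `X` for
the Euclidean topology and it agrees with `f` at every point where `f` is defined, i.e. with every
representative of `f` on the domain of that representative. -/
def IsContinuousExtension {X : RealAlgebraicVariety} (f : X.RationalFunction)
    (g : X.carrier → ℝ) : Prop :=
  @Continuous _ _ X.euclidean _ g ∧
    ∀ a : X.PartialRegular, Quotient.mk (PartialRegular.setoid X) a = f →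
      ∀ x ∈ a.domain, g x = a.toFun x

/-- `h` is hereditarily rational: it is continuous, and its restriction to every irreducible
subvariety is regular on a Zariski dense open subset of that subvariety. -/
def IsHereditarilyRational (X : RealAlgebraicVariety) (h : X.carrier → ℝ) : Prop :=
  @Continuous _ _ X.euclidean _ h ∧
    ∀ Z, X.IsIrreducibleSubvariety Z → ∃ Z₀, X.IsDenseOpenIn Z₀ Z ∧ X.IsRegularOn h Z₀

end RealAlgebraicVariety

end

/-! Work in a chart with model V, near a point z of Z whose local ring is regular, and write f = P/Q
where Q ≠ 0. The difficulty is that Q may vanish identically on Z. The remedy is to differentiate P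
and Q along a polynomial vector field D tangent to V. Its integral curves stay in V, and f^c is
continuous along them. So if D^j Q vanishes at v for all j < k while D^k Q does not, comparing
leading Taylor coefficients gives f^c(v) · D^k Q(v) = D^k P(v) (`mul_iterate_eq_of_continuousOn`).
Taking k least such that D^k Q is not identically zero on the part of Z near z, one gets f^c = D^k P
/ D^k Q on a nonempty open, hence dense, subset of Z.

It remains to find a D for which such a k exists. Regularity at z yields, by the Jacobian criterion
`exists_local_equations`, polynomials g_j in I(V) that generate it locally and have independent
gradients at z, together with parameters x_i completing these gradients to a basis. Cramer's rule
(`exists_tangent_derivation`) then gives D with D g_j = 0 and arbitrary prescribed values D x_i (z).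
By Krull's theorem Q has a finite order k along V at z; its initial form in the x_i is nonzero, and
a direction where this form does not vanish gives D^j Q(z) ≠ 0 for some j
(`exists_iterate_derivation_ne_zero`). The Jacobian criterion itself rests on regular local rings
being domains. -/

/-! ### Regular local rings -/

open IsLocalRing in
/-- In a local ring, quotienting by an element of `m \ m²` lowers the number of generators of the
maximal ideal. -/
lemma spanFinrank_maximalIdeal_quotient_lt {R : Type*} [CommRing R] [IsLocalRing R]
    [IsNoetherianRing R] {x : R} (hx : x ∈ maximalIdeal R) (hx2 : x ∉ maximalIdeal R ^ 2)
    [IsLocalRing (R ⧸ Ideal.span {x})] :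
    (maximalIdeal (R ⧸ Ideal.span {x})).spanFinrank < (maximalIdeal R).spanFinrank := by
  classical
  have fg := (maximalIdeal R).fg_of_isNoetherianRing
  have fin := Submodule.FG.finite_generators fg
  have hspan : Submodule.span R (fin.toFinset : Set R) = maximalIdeal R := by
    rw [Set.Finite.coe_toFinset]; exact (maximalIdeal R).span_generators
  have hcard : fin.toFinset.card = (maximalIdeal R).spanFinrank := by
    rw [← Submodule.FG.generators_ncard fg, Set.ncard_eq_toFinset_card _ fin]
  generalize fin.toFinset = s at hspan hcard
  obtain ⟨c, -, hc⟩ := Submodule.mem_span_finset.1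
    (hspan.symm ▸ hx : x ∈ Submodule.span R (s : Set R))
  have hsm : ∀ y ∈ s, y ∈ maximalIdeal R := fun y hy => hspan ▸ Submodule.subset_span hy
  -- Since x is outside m², some coefficient of x in terms of minimal generators is a unit; the
  -- corresponding generator becomes redundant modulo x.
  obtain ⟨y, hy, hcy⟩ : ∃ y ∈ s, c y ∉ maximalIdeal R := by
    by_contra! h
    apply hx2
    rw [← hc, pow_two]
    exact Ideal.sum_mem _ fun y hy => Ideal.mul_mem_mul (h y hy) (hsm y hy)
  have hu : IsUnit (c y) := by simpa using hcy
  have hmap : maximalIdeal (R ⧸ Ideal.span {x}) =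
      Ideal.span (((s.erase y).image (Ideal.Quotient.mk (Ideal.span {x})) : Finset _) :
        Set (R ⧸ Ideal.span {x})) := by
    have h1 : maximalIdeal (R ⧸ Ideal.span {x}) =
        (maximalIdeal R).map (Ideal.Quotient.mk (Ideal.span {x})) := by
      symm
      have : (maximalIdeal R).map (Ideal.Quotient.mk (Ideal.span {x})) ≠ ⊤ := by
        intro h
        have := congrArg (Ideal.comap (Ideal.Quotient.mk (Ideal.span {x}))) h
        rw [Ideal.comap_map_of_surjective _ Ideal.Quotient.mk_surjective,
          ← RingHom.ker_eq_comap_bot,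
          Ideal.mk_ker, Ideal.comap_top, sup_eq_left.2] at this
        · exact Ideal.IsPrime.ne_top' this
        · rwa [Ideal.span_singleton_le_iff_mem]
      refine IsLocalRing.eq_maximalIdeal ?_
      exact (Ideal.map_eq_top_or_isMaximal_of_surjective _ Ideal.Quotient.mk_surjective
        (maximalIdeal.isMaximal R)).resolve_left this
    rw [h1, ← hspan]
    change Ideal.map _ (Ideal.span _) = _
    rw [Ideal.map_span]
    apply le_antisymm
    · rw [Ideal.span_le]
      rintro _ ⟨w, hw, rfl⟩
      by_cases hwy : w = y
      · subst hwy
        obtain ⟨u, hu⟩ := hu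
        have key : Ideal.Quotient.mk (Ideal.span {x}) (c w * w) ∈
            Ideal.span (((s.erase w).image (Ideal.Quotient.mk (Ideal.span {x})) : Finset _) :
              Set (R ⧸ Ideal.span {x})) := by
          have : c w * w = x - ∑ a ∈ s.erase w, c a * a := by
            rw [← hc, ← Finset.add_sum_erase s _ hw]; simp
          rw [this, map_sub, map_sum,
            Ideal.Quotient.eq_zero_iff_mem.2 (Ideal.mem_span_singleton_self x),
            zero_sub, neg_mem_iff]
          refine Ideal.sum_mem _ fun a ha => ?_
          rw [map_mul]
          exact Ideal.mul_mem_left _ _ (Ideal.subset_span (by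
            rw [Finset.coe_image]; exact ⟨a, ha, rfl⟩))
        have hw' : (↑u⁻¹ : R) * (c w * w) = w := by rw [← hu, ← mul_assoc]; simp
        have := Ideal.mul_mem_left _ (Ideal.Quotient.mk (Ideal.span {x}) ↑u⁻¹) key
        rwa [← map_mul, hw'] at this
      · exact Ideal.subset_span (by
          rw [Finset.coe_image]; exact ⟨w, Finset.mem_erase.2 ⟨hwy, hw⟩, rfl⟩)
    · apply Ideal.span_mono
      rw [Finset.coe_image]
      exact Set.image_mono (Finset.coe_subset.2 (Finset.erase_subset _ _))
  rw [hmap, ← hcard]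
  refine (Submodule.spanFinrank_span_le_ncard_of_finite (Finset.finite_toSet _)).trans_lt ?_
  rw [Set.ncard_coe_finset]
  exact Finset.card_image_le.trans_lt (Finset.card_erase_lt_of_mem hy)

open IsLocalRing in
-- Choose x in m outside m² and outside every minimal prime. Then R/(x) is regular of dimension one
-- less, so by induction (x) is prime. A minimal prime P inside (x) does not contain x, hence P = xP
-- and P = 0 by Nakayama.
theorem IsRegularLocalRing.isDomain_aux.{u} (d : ℕ) :
    ∀ (R : Type u) [CommRing R] [IsRegularLocalRing R],
    (maximalIdeal R).spanFinrank = d → IsDomain R := by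
  induction d with
  | zero =>
    intro R _ _ h
    have h0 : maximalIdeal R = ⊥ :=
      (Submodule.spanFinrank_eq_zero_iff_eq_bot (maximalIdeal R).fg_of_isNoetherianRing).1 h
    exact (IsLocalRing.isField_iff_maximalIdeal_eq.2 h0).isDomain
  | succ d ih =>
    intro R _ _ h
    have hdim : ((d + 1 : ℕ) : WithBot ℕ∞) = ringKrullDim R := by
      rw [← h]; exact IsRegularLocalRing.spanFinrank_maximalIdeal
    have hm : maximalIdeal R ≠ ⊥ := by
      intro h0
      rw [h0, Submodule.spanFinrank_bot] at h
      omega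
    have hm2 : ¬ maximalIdeal R ≤ maximalIdeal R ^ 2 := by
      intro h2
      refine hm (Submodule.eq_bot_of_le_smul_of_le_jacobson_bot (maximalIdeal R) _
        (maximalIdeal R).fg_of_isNoetherianRing ?_ ?_)
      · rw [smul_eq_mul, ← pow_two]; exact h2
      · exact IsLocalRing.maximalIdeal_le_jacobson ⊥
    have hmin : ∀ P ∈ minimalPrimes R, ¬ maximalIdeal R ≤ P := by
      intro P hP hle
      have hPp : P.IsPrime := hP.1.1
      have : P = maximalIdeal R := le_antisymm (IsLocalRing.le_maximalIdeal hPp.ne_top) hle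
      have h0 : P.height = 0 := Ideal.height_eq_zero_iff.2 hP
      rw [this] at h0
      have := maximalIdeal_height_eq_ringKrullDim (R := R)
      rw [h0, ← hdim] at this
      exact absurd this.symm (by norm_cast)
    obtain ⟨x, hx, hx2, hxP⟩ : ∃ x ∈ maximalIdeal R, x ∉ maximalIdeal R ^ 2 ∧
        ∀ P ∈ minimalPrimes R, x ∉ P := by
      classical
      by_contra! hcon
      have hfin := minimalPrimes.finite_of_isNoetherianRing R
      have hsub : (maximalIdeal R : Set R) ⊆
          ⋃ i ∈ (↑(insert (maximalIdeal R ^ 2) hfin.toFinset) : Set (Ideal R)),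
            (id i : Ideal R) := by
        intro y hy
        simp only [Set.mem_iUnion]
        by_cases hy2 : y ∈ maximalIdeal R ^ 2
        · exact ⟨_, by simp, hy2⟩
        · obtain ⟨P, hP, hyP⟩ := hcon y hy hy2
          exact ⟨P, by simp [hP], hyP⟩
      -- Prime avoidance tolerates two members that need not be prime; here m² fills both
      -- exceptional slots.
      obtain ⟨P, hP, hle⟩ := (Ideal.subset_union_prime (maximalIdeal R ^ 2) (maximalIdeal R ^ 2)
        (fun i hi hi1 _ => by
          rcases Finset.mem_insert.1 hi with h | h
          · exact absurd h hi1
          · exact (hfin.mem_toFinset.1 h).1.1)).1 hsub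
      rcases Finset.mem_insert.1 hP with h | h
      · exact hm2 (h ▸ hle)
      · exact hmin P (hfin.mem_toFinset.1 h) hle
    have hxtop : Ideal.span {x} ≠ ⊤ := by
      intro h
      exact (Ideal.IsPrime.ne_top' : maximalIdeal R ≠ ⊤)
        (top_le_iff.1 (h ▸ (Ideal.span_singleton_le_iff_mem _).2 hx))
    have : Nontrivial (R ⧸ Ideal.span {x}) := Ideal.Quotient.nontrivial_iff.2 hxtop
    have : IsLocalRing (R ⧸ Ideal.span {x}) :=
      IsLocalRing.of_surjective' (Ideal.Quotient.mk (Ideal.span {x})) Ideal.Quotient.mk_surjective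
    have hlt := spanFinrank_maximalIdeal_quotient_lt hx hx2
    have hdimq : ringKrullDim R ≤ ringKrullDim (R ⧸ Ideal.span {x}) + 1 := by
      rw [← maximalIdeal_height_eq_ringKrullDim]
      exact Ideal.height_le_ringKrullDim_quotient_add_one hx
    have hd : ((d : ℕ) : WithBot ℕ∞) ≤ ringKrullDim (R ⧸ Ideal.span {x}) := by
      rw [← hdim] at hdimq
      push_cast at hdimq
      exact ENat.WithBot.add_le_add_one_right_iff.1 hdimq
    have hle : (maximalIdeal (R ⧸ Ideal.span {x})).spanFinrank ≤ d := by omega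
    have hreg : IsRegularLocalRing (R ⧸ Ideal.span {x}) :=
      IsRegularLocalRing.of_spanFinrank_maximalIdeal_le _ ((Nat.cast_le.2 hle).trans hd)
    have hde : (maximalIdeal (R ⧸ Ideal.span {x})).spanFinrank = d := by
      refine le_antisymm hle ?_
      have := hreg.spanFinrank_maximalIdeal
      rw [← this] at hd
      exact_mod_cast hd
    have hdom := ih (R ⧸ Ideal.span {x}) hde
    have hprime : (Ideal.span {x}).IsPrime := (Ideal.Quotient.isDomain_iff_prime _).1 hdom
    obtain ⟨P, hP, hPle⟩ := Ideal.exists_minimalPrimes_le (I := ⊥) (J := Ideal.span {x}) bot_le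
    have hPp : P.IsPrime := hP.1.1
    have hPbot : P = ⊥ := by
      refine Submodule.eq_bot_of_le_smul_of_le_jacobson_bot (maximalIdeal R) _
        P.fg_of_isNoetherianRing ?_ (IsLocalRing.maximalIdeal_le_jacobson ⊥)
      intro y hy
      obtain ⟨z, rfl⟩ := Ideal.mem_span_singleton.1 (hPle hy)
      exact Submodule.smul_mem_smul hx ((hPp.mem_or_mem hy).resolve_left (hxP P hP))
    rw [hPbot] at hPp
    have : NoZeroDivisors R := ⟨fun {a b} hab => by
      simpa using hPp.mem_or_mem (by simp [hab] : a * b ∈ _)⟩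
    exact NoZeroDivisors.to_isDomain R

theorem IsRegularLocalRing.isDomain (R : Type*) [CommRing R] [IsRegularLocalRing R] : IsDomain R :=
  IsRegularLocalRing.isDomain_aux _ R rfl

open IsLocalRing in
/-- If a surjection from a Noetherian local ring `R` onto a regular local ring `A` kills an ideal
`J` and the maximal ideal of `R` is generated by `J` and at most `dim A` elements, then `J` is
the kernel. -/
theorem ker_eq_of_isRegularLocalRing {R A : Type*} [CommRing R] [IsLocalRing R]
    [IsNoetherianRing R] [CommRing A] [IsRegularLocalRing A] (φ : R →+* A)
    (hφ : Function.Surjective φ) (J : Ideal R) (hJ : J ≤ RingHom.ker φ) (s : Finset R)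
    (hsm : (s : Set R) ⊆ maximalIdeal R) (hs : maximalIdeal R ≤ J ⊔ Ideal.span (s : Set R))
    (hcard : (s.card : WithBot ℕ∞) ≤ ringKrullDim A) :
    RingHom.ker φ = J := by
  classical
  have hJtop : J ≠ ⊤ := fun h => RingHom.ker_ne_top φ (top_le_iff.1 (h ▸ hJ))
  have : Nontrivial (R ⧸ J) := Ideal.Quotient.nontrivial_iff.2 hJtop
  have : IsLocalRing (R ⧸ J) :=
    IsLocalRing.of_surjective' (Ideal.Quotient.mk J) Ideal.Quotient.mk_surjective
  let ψ : R ⧸ J →+* A := Ideal.Quotient.lift J φ hJ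
  have hψ : Function.Surjective ψ := Ideal.Quotient.lift_surjective_of_surjective J hJ hφ
  have hdim : ringKrullDim A ≤ ringKrullDim (R ⧸ J) := ringKrullDim_le_of_surjective ψ hψ
  have hmax : maximalIdeal (R ⧸ J) ≤
      Ideal.span ((s.image (Ideal.Quotient.mk J) : Finset _) : Set (R ⧸ J)) := by
    intro y hy
    obtain ⟨y, rfl⟩ := Ideal.Quotient.mk_surjective y
    have hy' : y ∈ maximalIdeal R := by
      rw [mem_maximalIdeal, mem_nonunits_iff] at hy ⊢
      exact fun h => hy (h.map _)
    have := Ideal.mem_map_of_mem (Ideal.Quotient.mk J) (hs hy')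
    rwa [Ideal.map_sup, Ideal.map_quotient_self, bot_sup_eq, Ideal.map_span,
      ← Finset.coe_image] at this
  have hmax' : maximalIdeal (R ⧸ J) =
      Ideal.span ((s.image (Ideal.Quotient.mk J) : Finset _) : Set (R ⧸ J)) := by
    refine le_antisymm hmax (Ideal.span_le.2 ?_)
    rw [Finset.coe_image]
    rintro _ ⟨y, hy, rfl⟩
    have : IsLocalHom (Ideal.Quotient.mk J) :=
      IsLocalHom.of_surjective _ Ideal.Quotient.mk_surjective
    exact (IsLocalRing.mem_maximalIdeal _).2 fun h =>
      (IsLocalRing.mem_maximalIdeal _).1 (hsm hy) (isUnit_of_map_unit _ _ h)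
  have hle : (maximalIdeal (R ⧸ J)).spanFinrank ≤ s.card := by
    rw [hmax']
    refine (Submodule.spanFinrank_span_le_ncard_of_finite (Finset.finite_toSet _)).trans ?_
    rw [Set.ncard_coe_finset]
    exact Finset.card_image_le
  -- R/J has embedding dimension at most dim A, which is at most dim R/J because R/J surjects onto
  -- A.
  have hreg : IsRegularLocalRing (R ⧸ J) :=
    IsRegularLocalRing.of_spanFinrank_maximalIdeal_le _
      (((Nat.cast_le.2 hle).trans hcard).trans hdim)
  have hdom := IsRegularLocalRing.isDomain (R ⧸ J)
  refine le_antisymm (fun y hy => ?_) hJ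
  by_contra hyJ
  -- A nonzero element of the domain R/J killed in A would lower the dimension on passing to the
  -- quotient. That quotient still surjects onto A, whose dimension is at least that of R/J.
  have hr : Ideal.Quotient.mk J y ≠ 0 := by rwa [Ne, Ideal.Quotient.eq_zero_iff_mem]
  have h1 := ringKrullDim_quotient_succ_le_of_nonZeroDivisor (mem_nonZeroDivisors_of_ne_zero hr)
  have h2 : ringKrullDim A ≤ ringKrullDim ((R ⧸ J) ⧸ Ideal.span {Ideal.Quotient.mk J y}) := by
    refine ringKrullDim_le_of_surjective (Ideal.Quotient.lift _ ψ ?_)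
      (Ideal.Quotient.lift_surjective_of_surjective _ _ hψ)
    intro a ha
    obtain ⟨b, rfl⟩ := Ideal.mem_span_singleton.1 ha
    rw [map_mul, show ψ (Ideal.Quotient.mk J y) = 0 from hy, zero_mul]
  have h3 : ringKrullDim (R ⧸ J) + 1 ≤ ringKrullDim (R ⧸ J) := by
    refine le_trans ?_ h1
    refine ENat.WithBot.add_le_add_one_right_iff.2 (le_trans ?_ h2)
    rw [← hreg.spanFinrank_maximalIdeal]
    exact (Nat.cast_le.2 hle).trans hcard
  rw [← hreg.spanFinrank_maximalIdeal] at h3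
  norm_cast at h3
  omega

/-! ### Gradients of polynomials at a point -/

noncomputable section

namespace MvPolynomial

variable {n : ℕ}

/-- The gradient of a polynomial at a point. -/
def gradAt (z : Fin n → ℝ) : MvPolynomial (Fin n) ℝ →ₗ[ℝ] (Fin n → ℝ) where
  toFun f i := eval z (pderiv i f)
  map_add' f g := by ext i; simp
  map_smul' c f := by ext i; simp [smul_eval]

lemma gradAt_mul (z : Fin n → ℝ) (f g : MvPolynomial (Fin n) ℝ) :
    gradAt z (f * g) = eval z f • gradAt z g + eval z g • gradAt z f := by
  ext i; simp [gradAt, Derivation.leibniz]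

/-- The linear polynomial with gradient `w` vanishing at `z`. -/
def linPoly (z w : Fin n → ℝ) : MvPolynomial (Fin n) ℝ := ∑ i, C (w i) * (X i - C (z i))

@[simp] lemma eval_linPoly_self (z w : Fin n → ℝ) : eval z (linPoly z w) = 0 := by
  simp [linPoly]

lemma gradAt_linPoly (z w : Fin n → ℝ) : gradAt z (linPoly z w) = w := by
  ext i
  simp [gradAt, linPoly, Derivation.leibniz, pderiv_X, Pi.single_apply, apply_ite]

/-- First-order Taylor formula. Multiplying by a variable adds to the remainder only a product of
two polynomials vanishing at z. -/
lemma sub_linPoly_mem_sq (z : Fin n → ℝ) (f : MvPolynomial (Fin n) ℝ) :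
    f - C (eval z f) - linPoly z (gradAt z f) ∈ RingHom.ker (eval z) ^ 2 := by
  induction f using MvPolynomial.induction_on with
  | C a =>
    have : gradAt z (C a) = 0 := by ext i; simp [gradAt]
    rw [this]; simp [linPoly]
  | add p q hp hq =>
    convert add_mem hp hq using 1
    simp only [map_add, linPoly, Pi.add_apply, add_mul, Finset.sum_add_distrib]
    ring
  | mul_X p i hp =>
    have h1 : gradAt z (p * X i) = z i • gradAt z p + eval z p • Pi.single i (1 : ℝ) := by
      rw [gradAt_mul, add_comm]
      congr 2
      · simp
      · ext j; simp [gradAt, pderiv_X, Pi.single_apply, eq_comm, apply_ite]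
    have h2 : linPoly z (gradAt z (p * X i)) =
        C (z i) * linPoly z (gradAt z p) + C (eval z p) * (X i - C (z i)) := by
      rw [h1]
      simp only [linPoly, Pi.add_apply, Pi.smul_apply, smul_eq_mul, map_add, map_mul, add_mul,
        Finset.sum_add_distrib, Finset.mul_sum, mul_assoc]
      congr 1
      rw [Finset.sum_eq_single i] <;> simp +contextual
    have h3 : p * X i - C (eval z (p * X i)) - linPoly z (gradAt z (p * X i)) =
        C (z i) * (p - C (eval z p) - linPoly z (gradAt z p)) +
          (p - C (eval z p)) * (X i - C (z i)) := by
      rw [h2]; simp only [map_mul, eval_X]; ring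
    rw [h3]
    refine add_mem (Ideal.mul_mem_left _ _ hp) ?_
    rw [pow_two]
    exact Ideal.mul_mem_mul (by simp [RingHom.mem_ker]) (by simp [RingHom.mem_ker])

lemma mem_sq_of_gradAt_eq_zero {z : Fin n → ℝ} {f : MvPolynomial (Fin n) ℝ} (h0 : eval z f = 0)
    (h1 : gradAt z f = 0) : f ∈ RingHom.ker (eval z) ^ 2 := by
  simpa [h0, h1, linPoly] using sub_linPoly_mem_sq z f

/-- The generators vanish at z, so by Leibniz differentiating the coefficients contributes nothing.
-/
lemma gradAt_mem_span {z : Fin n → ℝ} {T : Set (MvPolynomial (Fin n) ℝ)}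
    (hT : ∀ a ∈ T, eval z a = 0) {f : MvPolynomial (Fin n) ℝ} (hf : f ∈ Ideal.span T) :
    gradAt z f ∈ Submodule.span ℝ (gradAt z '' T) := by
  have key : eval z f = 0 ∧ gradAt z f ∈ Submodule.span ℝ (gradAt z '' T) := by
    refine Submodule.span_induction ?_ ?_ ?_ ?_ hf
    · exact fun a ha => ⟨hT a ha, Submodule.subset_span ⟨a, ha, rfl⟩⟩
    · simp
    · rintro x y - - ⟨hx, hx'⟩ ⟨hy, hy'⟩
      exact ⟨by simp [hx, hy], by rw [map_add]; exact add_mem hx' hy'⟩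
    · rintro a x - ⟨hx, hx'⟩
      refine ⟨by simp [hx], ?_⟩
      rw [smul_eq_mul, gradAt_mul, hx, zero_smul, add_zero]
      exact Submodule.smul_mem _ _ hx'
  exact key.2

/-- The ideal is finitely generated; multiply the multipliers of its generators. -/
lemma exists_uniform_multiplier {z : Fin n → ℝ} {I J : Ideal (MvPolynomial (Fin n) ℝ)}
    (h : ∀ f ∈ I, ∃ u, eval z u ≠ 0 ∧ u * f ∈ J) :
    ∃ u, eval z u ≠ 0 ∧ ∀ f ∈ I, u * f ∈ J := by
  classical
  obtain ⟨T, hT⟩ := (inferInstance : IsNoetherianRing (MvPolynomial (Fin n) ℝ)).noetherian I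
  have h' : ∀ f : T, ∃ u, eval z u ≠ 0 ∧ u * f.1 ∈ J := fun f =>
    h f.1 (hT ▸ Submodule.subset_span f.2)
  choose u hu0 hu using h'
  refine ⟨∏ f, u f, by simp [map_prod, Finset.prod_ne_zero_iff, hu0], fun f hf => ?_⟩
  rw [← hT] at hf
  refine Submodule.span_induction ?_ ?_ ?_ ?_ hf
  · intro f hf
    rw [← Finset.mul_prod_erase _ _ (Finset.mem_univ ⟨f, hf⟩), mul_right_comm]
    exact Ideal.mul_mem_right _ _ (hu ⟨f, hf⟩)
  · simp
  · intro x y _ _ hx hy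
    rw [mul_add]; exact add_mem hx hy
  · intro a x _ hx
    rw [smul_eq_mul, mul_left_comm]; exact Ideal.mul_mem_left _ _ hx

end MvPolynomial

open MvPolynomial

variable {n : ℕ} {V : Set (Fin n → ℝ)}

/-! ### The local ring of an affine variety at a point -/

/-- The canonical map from polynomials to the local ring of `V` at `z`. -/
def toAffineLocalRing (z : V) : MvPolynomial (Fin n) ℝ →+* AffineLocalRing z :=
  (algebraMap (CoordRing V) (AffineLocalRing z)).comp (Ideal.Quotient.mk (vanishingIdeal ℝ V))

lemma toAffineLocalRing_eq_zero_iff (z : V) (f : MvPolynomial (Fin n) ℝ) :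
    toAffineLocalRing z f = 0 ↔ ∃ u, eval z.1 u ≠ 0 ∧ u * f ∈ vanishingIdeal ℝ V := by
  rw [toAffineLocalRing, RingHom.comp_apply,
    IsLocalization.map_eq_zero_iff (RingHom.ker (CoordRing.evalAt z)).primeCompl]
  constructor
  · rintro ⟨⟨u, hu⟩, h⟩
    obtain ⟨u, rfl⟩ := Ideal.Quotient.mk_surjective u
    refine ⟨u, hu, ?_⟩
    rw [← Ideal.Quotient.eq_zero_iff_mem, map_mul]; exact h
  · rintro ⟨u, hu, h⟩
    refine ⟨⟨Ideal.Quotient.mk _ u, hu⟩, ?_⟩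
    rw [← Ideal.Quotient.eq_zero_iff_mem, map_mul] at h; exact h

lemma isUnit_toAffineLocalRing (z : V) {f : MvPolynomial (Fin n) ℝ} (hf : eval z.1 f ≠ 0) :
    IsUnit (toAffineLocalRing z f) :=
  IsLocalization.map_units (AffineLocalRing z)
    (⟨Ideal.Quotient.mk _ f, hf⟩ : (RingHom.ker (CoordRing.evalAt z)).primeCompl)

lemma exists_toAffineLocalRing_mul_eq (z : V) (y : AffineLocalRing z) :
    ∃ a b, eval z.1 b ≠ 0 ∧ y * toAffineLocalRing z b = toAffineLocalRing z a := by
  obtain ⟨⟨a, b, hb⟩, h⟩ := IsLocalization.surj (RingHom.ker (CoordRing.evalAt z)).primeCompl y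
  obtain ⟨a, rfl⟩ := Ideal.Quotient.mk_surjective a
  obtain ⟨b, rfl⟩ := Ideal.Quotient.mk_surjective b
  exact ⟨a, b, hb, h⟩

lemma toAffineLocalRing_mem_maximalIdeal (z : V) {f : MvPolynomial (Fin n) ℝ}
    (hf : toAffineLocalRing z f ∈ IsLocalRing.maximalIdeal (AffineLocalRing z)) :
    eval z.1 f = 0 := by
  by_contra h
  exact (IsLocalRing.mem_maximalIdeal _).1 hf (isUnit_toAffineLocalRing z h)

lemma mem_map_toAffineLocalRing (z : V) (J : Ideal (MvPolynomial (Fin n) ℝ))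
    {f : MvPolynomial (Fin n) ℝ} (hf : toAffineLocalRing z f ∈ J.map (toAffineLocalRing z)) :
    ∃ u, eval z.1 u ≠ 0 ∧ ∃ a ∈ J, u * f - a ∈ vanishingIdeal ℝ V := by
  rw [toAffineLocalRing, ← Ideal.map_map, RingHom.comp_apply,
    IsLocalization.algebraMap_mem_map_algebraMap_iff
      (RingHom.ker (CoordRing.evalAt z)).primeCompl] at hf
  obtain ⟨u, hu, h⟩ := hf
  obtain ⟨u, rfl⟩ := Ideal.Quotient.mk_surjective u
  rw [← map_mul, Ideal.mem_map_iff_of_surjective _ Ideal.Quotient.mk_surjective] at h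
  obtain ⟨a, ha, h⟩ := h
  exact ⟨u, hu, a, ha, Ideal.Quotient.eq.1 h.symm⟩

/-! ### Conormal space and Jacobian criterion -/

/-- The conormal space of `V` at `z`: the gradients at `z` of the polynomials vanishing on `V`. -/
def conormalSpace (V : Set (Fin n → ℝ)) (z : Fin n → ℝ) : Submodule ℝ (Fin n → ℝ) :=
  ((vanishingIdeal ℝ V).restrictScalars ℝ).map (gradAt z)

lemma gradAt_mem_conormalSpace (z : Fin n → ℝ) {f : MvPolynomial (Fin n) ℝ}
    (hf : f ∈ vanishingIdeal ℝ V) : gradAt z f ∈ conormalSpace V z :=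
  ⟨f, hf, rfl⟩

lemma eval_eq_zero_of_mem_vanishingIdeal {f : MvPolynomial (Fin n) ℝ}
    (hf : f ∈ vanishingIdeal ℝ V) {z : Fin n → ℝ} (hz : z ∈ V) : eval z f = 0 := by
  have := hf z hz
  rwa [aeval_eq_eval] at this

/-- The embedding dimension of `V` at `z` is at least the codimension of the conormal space. -/
lemma le_finrank_conormalSpace_add (z : V) :
    n ≤ Module.finrank ℝ (conormalSpace V z.1) +
      (IsLocalRing.maximalIdeal (AffineLocalRing z)).spanFinrank := by
  classical
  have fg := (IsLocalRing.maximalIdeal (AffineLocalRing z)).fg_of_isNoetherianRing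
  have fin := Submodule.FG.finite_generators fg
  have hspan : Ideal.span (fin.toFinset : Set (AffineLocalRing z)) =
      IsLocalRing.maximalIdeal (AffineLocalRing z) := by
    rw [Set.Finite.coe_toFinset]; exact (IsLocalRing.maximalIdeal _).span_generators
  have hcard : fin.toFinset.card = (IsLocalRing.maximalIdeal (AffineLocalRing z)).spanFinrank := by
    rw [← Submodule.FG.generators_ncard fg, Set.ncard_eq_toFinset_card _ fin]
  generalize fin.toFinset = t at hspan hcard
  choose a b hb hab using exists_toAffineLocalRing_mul_eq z
  have ha : ∀ y ∈ t, eval z.1 (a y) = 0 := by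
    intro y hy
    refine toAffineLocalRing_mem_maximalIdeal z ?_
    rw [← hab]
    exact Ideal.mul_mem_right _ _ (hspan ▸ Ideal.subset_span hy)
  have hle : IsLocalRing.maximalIdeal (AffineLocalRing z) ≤
      (Ideal.span (t.image a : Set (MvPolynomial (Fin n) ℝ))).map (toAffineLocalRing z) := by
    rw [← hspan, Ideal.span_le]
    intro y hy
    refine (Ideal.mul_unit_mem_iff_mem _ (isUnit_toAffineLocalRing z (hb y))).1 ?_
    rw [hab]
    exact Ideal.mem_map_of_mem _ (Ideal.subset_span (by simpa using ⟨y, hy, rfl⟩))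
  -- The linear polynomial with gradient w lies in the maximal ideal. Up to a factor u with u(z) ≠ 0
  -- it is therefore, modulo I(V), a combination of the lifted generators; taking gradients at z
  -- places u(z) w in the sum.
  have htop : conormalSpace V z.1 ⊔
      Submodule.span ℝ ((t.image a).image (gradAt z.1) : Set (Fin n → ℝ)) = ⊤ := by
    rw [eq_top_iff]
    intro w _
    have h1 : toAffineLocalRing z (linPoly z.1 w) ∈
        IsLocalRing.maximalIdeal (AffineLocalRing z) := by
      refine (IsLocalization.AtPrime.to_map_mem_maximal_iff (AffineLocalRing z)
        (RingHom.ker (CoordRing.evalAt z)) _).2 ?_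
      exact eval_linPoly_self z.1 w
    obtain ⟨u, hu, c, hc, h⟩ := mem_map_toAffineLocalRing z _ (hle h1)
    have h2 := gradAt_mem_conormalSpace z.1 h
    have h3 : gradAt z.1 c ∈
        Submodule.span ℝ ((t.image a).image (gradAt z.1) : Set (Fin n → ℝ)) := by
      rw [Finset.coe_image]
      refine gradAt_mem_span ?_ hc
      intro x hx
      obtain ⟨y, hy, rfl⟩ := Finset.mem_image.1 (Finset.mem_coe.1 hx)
      exact ha y hy
    rw [map_sub, gradAt_mul, gradAt_linPoly, eval_linPoly_self, zero_smul, add_zero] at h2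
    have h4 : eval z.1 u • w ∈ conormalSpace V z.1 ⊔
        Submodule.span ℝ ((t.image a).image (gradAt z.1) : Set (Fin n → ℝ)) := by
      rw [← sub_add_cancel (eval z.1 u • w) (gradAt z.1 c)]
      exact add_mem (Submodule.mem_sup_left h2) (Submodule.mem_sup_right h3)
    exact (Submodule.smul_mem_iff _ hu).1 h4
  calc n = Module.finrank ℝ (Fin n → ℝ) := by simp
    _ = Module.finrank ℝ (⊤ : Submodule ℝ (Fin n → ℝ)) := (finrank_top ℝ _).symm
    _ ≤ _ := by
      rw [← htop]
      refine (Submodule.finrank_add_le_finrank_add_finrank _ _).trans ?_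
      refine Nat.add_le_add_left ?_ _
      rw [← hcard]
      exact (finrank_span_finset_le_card _).trans (Finset.card_image_le.trans Finset.card_image_le)

/-- Subtract the real linear combination of the g and x having the same gradient as f; what is left
vanishes to second order. -/
lemma le_span_sup_sq_of_basis {c e : ℕ} {z : Fin n → ℝ} {g : Fin c → MvPolynomial (Fin n) ℝ}
    {x : Fin e → MvPolynomial (Fin n) ℝ} (hg : ∀ j, eval z (g j) = 0)
    (hx : ∀ i, eval z (x i) = 0) (b : Module.Basis (Fin c ⊕ Fin e) ℝ (Fin n → ℝ))
    (hbl : ∀ j, b (Sum.inl j) = gradAt z (g j)) (hbr : ∀ i, b (Sum.inr i) = gradAt z (x i)) :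
    RingHom.ker (eval z) ≤
      Ideal.span (Set.range g) ⊔ Ideal.span (Set.range x) ⊔ RingHom.ker (eval z) ^ 2 := by
  intro f hf
  have h1 := b.sum_repr (gradAt z f)
  rw [Fintype.sum_sum_type] at h1
  simp only [hbl, hbr, ← map_smul, ← map_sum, ← map_add] at h1
  generalize b.repr (gradAt z f) = a at h1
  have hpg : ∑ j, a (Sum.inl j) • g j ∈ Ideal.span (Set.range g) := Ideal.sum_mem _ fun j _ => by
    rw [smul_eq_C_mul]; exact Ideal.mul_mem_left _ _ (Ideal.subset_span ⟨j, rfl⟩)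
  have hqx : ∑ i, a (Sum.inr i) • x i ∈ Ideal.span (Set.range x) := Ideal.sum_mem _ fun j _ => by
    rw [smul_eq_C_mul]; exact Ideal.mul_mem_left _ _ (Ideal.subset_span ⟨j, rfl⟩)
  have hp0 : eval z (∑ j, a (Sum.inl j) • g j) = 0 := by
    rw [map_sum]
    exact Finset.sum_eq_zero fun j _ => by rw [smul_eval, hg, mul_zero]
  have hq0 : eval z (∑ i, a (Sum.inr i) • x i) = 0 := by
    rw [map_sum]
    exact Finset.sum_eq_zero fun j _ => by rw [smul_eval, hx, mul_zero]
  have h2 : f - (∑ j, a (Sum.inl j) • g j + ∑ i, a (Sum.inr i) • x i) ∈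
      RingHom.ker (eval z) ^ 2 := by
    apply mem_sq_of_gradAt_eq_zero
    · rw [map_sub, map_add, hp0, hq0, (RingHom.mem_ker).1 hf]; simp
    · rw [map_sub, h1, sub_self]
  rw [← add_sub_cancel (∑ j, a (Sum.inl j) • g j + ∑ i, a (Sum.inr i) • x i) f]
  exact Submodule.add_mem_sup (Submodule.add_mem_sup hpg hqx) h2

instance ker_eval_isPrime (z : Fin n → ℝ) : (RingHom.ker (eval z)).IsPrime :=
  RingHom.ker_isPrime _

/-- Restriction of germs from the affine space to `V`. -/
def germRestriction (z : V) :
    Localization.AtPrime (RingHom.ker (eval z.1)) →+* AffineLocalRing z :=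
  Localization.localRingHom (RingHom.ker (eval z.1))
    (RingHom.ker (CoordRing.evalAt z)) (Ideal.Quotient.mk (vanishingIdeal ℝ V)) rfl

lemma germRestriction_algebraMap (z : V) (f : MvPolynomial (Fin n) ℝ) :
    germRestriction z (algebraMap _ _ f) = toAffineLocalRing z f :=
  Localization.localRingHom_to_map _ _ _ _ f

lemma germRestriction_surjective (z : V) : Function.Surjective (germRestriction z) := by
  intro y
  obtain ⟨a, d, hd, h⟩ := exists_toAffineLocalRing_mul_eq z y
  obtain ⟨v, hv⟩ : IsUnit (algebraMap _ (Localization.AtPrime (RingHom.ker (eval z.1))) d) :=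
    IsLocalization.map_units _ (⟨d, hd⟩ : (RingHom.ker (eval z.1)).primeCompl)
  refine ⟨algebraMap _ _ a * (↑v⁻¹ : Localization.AtPrime (RingHom.ker (eval z.1))), ?_⟩
  refine (isUnit_toAffineLocalRing z hd).mul_right_cancel ?_
  rw [h, ← germRestriction_algebraMap z d, ← map_mul, mul_assoc, ← hv, Units.inv_mul, mul_one,
    germRestriction_algebraMap]

open IsLocalRing in
-- Nakayama removes p², so the maximal ideal of R is generated by G and at most dim A further
-- elements. `ker_eq_of_isRegularLocalRing` then identifies the kernel with the extension of G, and
-- u clears a denominator.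
lemma exists_mul_mem_of_isRegularLocalRing {S R A : Type*} [CommRing S] [CommRing R] [CommRing A]
    [Algebra S R] (p : Ideal S) [p.IsPrime] [IsLocalization.AtPrime R p] [IsLocalRing R]
    [IsNoetherianRing R] [IsRegularLocalRing A] (φ : R →+* A) (hφ : Function.Surjective φ)
    {G : Ideal S} (hG : ∀ f ∈ G, φ (algebraMap S R f) = 0) {e : ℕ} {x : Fin e → S}
    (hx : ∀ i, x i ∈ p) (hcot : p ≤ G ⊔ Ideal.span (Set.range x) ⊔ p ^ 2)
    (he : e ≤ (maximalIdeal A).spanFinrank) {f : S} (hf : φ (algebraMap S R f) = 0) :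
    ∃ u ∉ p, u * f ∈ G := by
  classical
  have hmax : p.map (algebraMap S R) = maximalIdeal R :=
    IsLocalization.AtPrime.map_eq_maximalIdeal p R
  obtain ⟨T, hT⟩ : ∃ T : Finset R, T = Finset.univ.image fun i => algebraMap S R (x i) := ⟨_, rfl⟩
  have hTc : T.card ≤ e := by
    rw [hT]
    exact Finset.card_image_le.trans (by simp)
  have hTr : (T : Set R) = algebraMap S R '' Set.range x := by
    rw [hT]; simp [← Set.range_comp, Function.comp_def]
  have hTm : (T : Set R) ⊆ maximalIdeal R := by
    rw [hTr, ← hmax]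
    rintro _ ⟨_, ⟨i, rfl⟩, rfl⟩
    exact Ideal.mem_map_of_mem _ (hx i)
  have hs : maximalIdeal R ≤ G.map (algebraMap S R) ⊔ Ideal.span (T : Set R) := by
    refine Submodule.le_of_le_smul_of_le_jacobson_bot (I := maximalIdeal R)
      (maximalIdeal R).fg_of_isNoetherianRing (IsLocalRing.maximalIdeal_le_jacobson ⊥) ?_
    have h1 := Ideal.map_mono (f := algebraMap S R) hcot
    rw [Ideal.map_sup, Ideal.map_sup, Ideal.map_pow, hmax, Ideal.map_span _ (Set.range x),
      pow_two, ← hTr] at h1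
    exact h1
  have hcard : (T.card : WithBot ℕ∞) ≤ ringKrullDim A := by
    rw [← IsRegularLocalRing.spanFinrank_maximalIdeal]
    exact Nat.cast_le.2 (hTc.trans he)
  have hker := ker_eq_of_isRegularLocalRing φ hφ (G.map (algebraMap S R))
    (Ideal.map_le_iff_le_comap.2 hG) T hTm hs hcard
  have h1 : algebraMap S R f ∈ G.map (algebraMap S R) := by
    rw [← hker]; exact hf
  exact (IsLocalization.algebraMap_mem_map_algebraMap_iff p.primeCompl _ _ _).1 h1

lemma exists_mul_mem_span_of_basis (z : V) (hreg : IsRegularLocalRing (AffineLocalRing z))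
    {c e : ℕ} {g : Fin c → MvPolynomial (Fin n) ℝ} {x : Fin e → MvPolynomial (Fin n) ℝ}
    (hgI : ∀ j, g j ∈ vanishingIdeal ℝ V) (hx : ∀ i, eval z.1 (x i) = 0)
    (hcot : RingHom.ker (eval z.1) ≤
      Ideal.span (Set.range g) ⊔ Ideal.span (Set.range x) ⊔ RingHom.ker (eval z.1) ^ 2)
    (he : e ≤ (IsLocalRing.maximalIdeal (AffineLocalRing z)).spanFinrank)
    {f : MvPolynomial (Fin n) ℝ} (hf : f ∈ vanishingIdeal ℝ V) :
    ∃ u, eval z.1 u ≠ 0 ∧ u * f ∈ Ideal.span (Set.range g) := by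
  have h0 : ∀ f ∈ vanishingIdeal ℝ V, germRestriction z (algebraMap _ _ f) = 0 := fun f hf => by
    rw [germRestriction_algebraMap, toAffineLocalRing_eq_zero_iff]
    exact ⟨1, by simp, by simpa using hf⟩
  have hG : ∀ f ∈ Ideal.span (Set.range g), germRestriction z (algebraMap _ _ f) = 0 :=
    fun f hf => h0 f ((Ideal.span_le.2 (Set.range_subset_iff.2 hgI)) hf)
  have hx' : ∀ i, x i ∈ RingHom.ker (eval z.1) := fun i => RingHom.mem_ker.2 (hx i)
  have h1 := h0 f hf
  have h2 := germRestriction_surjective z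
  generalize germRestriction z = φ at *
  obtain ⟨u, hu, h⟩ := @exists_mul_mem_of_isRegularLocalRing (MvPolynomial (Fin n) ℝ)
    (Localization.AtPrime (RingHom.ker (eval z.1))) (AffineLocalRing z) _ _ _ _
    (RingHom.ker (eval z.1)) _ inferInstance inferInstance inferInstance hreg φ h2 _ hG _ x hx'
    hcot he f h1
  exact ⟨u, fun h => hu (RingHom.mem_ker.2 h), h⟩

/-- **Jacobian criterion.** Near a point `z` at which the local ring of `V` is regular, the
polynomials `g j` cut out `V`, and their gradients at `z` together with those of the local
parameters `x i` form a basis. -/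
theorem exists_local_equations (z : V) (hreg : IsRegularLocalRing (AffineLocalRing z)) :
    ∃ (c e : ℕ) (g : Fin c → MvPolynomial (Fin n) ℝ) (x : Fin e → MvPolynomial (Fin n) ℝ)
      (s : MvPolynomial (Fin n) ℝ) (b : Module.Basis (Fin c ⊕ Fin e) ℝ (Fin n → ℝ)),
      (∀ j, g j ∈ vanishingIdeal ℝ V) ∧ (∀ i, eval z.1 (x i) = 0) ∧ eval z.1 s ≠ 0 ∧
      (∀ f ∈ vanishingIdeal ℝ V, s * f ∈ Ideal.span (Set.range g)) ∧
      (∀ j, b (Sum.inl j) = gradAt z.1 (g j)) ∧ ∀ i, b (Sum.inr i) = gradAt z.1 (x i) := by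
  obtain ⟨W', hW'⟩ := Submodule.exists_isCompl (conormalSpace V z.1)
  -- This bounds the number of parameters by the embedding dimension, which under regularity is the
  -- Krull dimension: exactly what the kernel criterion needs.
  have he : Module.finrank ℝ W' ≤
      (IsLocalRing.maximalIdeal (AffineLocalRing z)).spanFinrank := by
    have h2 := le_finrank_conormalSpace_add z
    have h3 := Submodule.finrank_add_eq_of_isCompl hW'
    rw [Module.finrank_fin_fun] at h3
    omega
  have hg : ∀ j, ∃ f ∈ vanishingIdeal ℝ V,
      gradAt z.1 f = (Module.finBasis ℝ (conormalSpace V z.1) j : Fin n → ℝ) :=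
    fun j => (Module.finBasis ℝ (conormalSpace V z.1) j).2
  choose g hgI hg using hg
  obtain ⟨x, hx⟩ : ∃ x : Fin (Module.finrank ℝ W') → MvPolynomial (Fin n) ℝ,
      ∀ i, x i = linPoly z.1 (Module.finBasis ℝ W' i : Fin n → ℝ) := ⟨_, fun _ => rfl⟩
  obtain ⟨b, hb⟩ : ∃ b, b = ((Module.finBasis ℝ (conormalSpace V z.1)).prod
    (Module.finBasis ℝ W')).map (Submodule.prodEquivOfIsCompl _ _ hW') := ⟨_, rfl⟩
  have hbl : ∀ j, b (Sum.inl j) = gradAt z.1 (g j) := fun j => by simp [hb, hg]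
  have hbr : ∀ i, b (Sum.inr i) = gradAt z.1 (x i) := fun i => by simp [hb, hx, gradAt_linPoly]
  have hx0 : ∀ i, eval z.1 (x i) = 0 := fun i => by rw [hx, eval_linPoly_self]
  have hcot := le_span_sup_sq_of_basis
    (fun j => eval_eq_zero_of_mem_vanishingIdeal (hgI j) z.2) hx0 b hbl hbr
  obtain ⟨s, hs0, hs⟩ := exists_uniform_multiplier fun f hf =>
    exists_mul_mem_span_of_basis z hreg hgI hx0 hcot he (f := f) hf
  exact ⟨_, _, g, x, s, b, hgI, hx0, hs0, hs, hbl, hbr⟩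

/-! ### Polynomial vector fields tangent to `V` -/

/-- The constant vector field `w`. -/
def constDerivation (w : Fin n → ℝ) :
    Derivation ℝ (MvPolynomial (Fin n) ℝ) (MvPolynomial (Fin n) ℝ) := ∑ i, w i • pderiv i

lemma eval_constDerivation (w z : Fin n → ℝ) (f : MvPolynomial (Fin n) ℝ) :
    eval z (constDerivation w f) = ∑ i, gradAt z f i * w i := by
  have : constDerivation w f = ∑ i, w i • pderiv i f := by
    rw [constDerivation, ← Derivation.coeFnAddMonoidHom_apply, map_sum, Finset.sum_apply]; rfl
  simp [this, gradAt, smul_eval, mul_comm]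

lemma eval_constDerivation_of_linearMap (ψ : (Fin n → ℝ) →ₗ[ℝ] ℝ) (z : Fin n → ℝ)
    (f : MvPolynomial (Fin n) ℝ) :
    eval z (constDerivation (fun i => ψ (Pi.single i 1)) f) = ψ (gradAt z f) := by
  rw [eval_constDerivation, LinearMap.pi_apply_eq_sum_univ ψ (gradAt z f)]
  refine Finset.sum_congr rfl fun i _ => ?_
  rw [smul_eq_mul]
  congr 2
  ext j
  simp [Pi.single_apply, eq_comm]

/-- Polynomial vector fields tangent to all level sets of the `g j`, with prescribed values of the
derivatives of the `x i` at `z`. -/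
theorem exists_tangent_derivation {c e : ℕ} (z : Fin n → ℝ) (g : Fin c → MvPolynomial (Fin n) ℝ)
    (x : Fin e → MvPolynomial (Fin n) ℝ) (b : Module.Basis (Fin c ⊕ Fin e) ℝ (Fin n → ℝ))
    (hbl : ∀ j, b (Sum.inl j) = gradAt z (g j)) (hbr : ∀ i, b (Sum.inr i) = gradAt z (x i))
    (α : Fin e → ℝ) :
    ∃ D : Derivation ℝ (MvPolynomial (Fin n) ℝ) (MvPolynomial (Fin n) ℝ),
      (∀ j, D (g j) = 0) ∧ ∀ i, eval z (D (x i)) = α i := by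
  classical
  -- At z, `D₀` already has the required values, and the `E l` are dual to the g. Away from z, `D₀
  -- (g j)` must be corrected by a combination of the `E l`.
  let D₀ := constDerivation fun i => b.constr ℝ (Sum.elim 0 α) (Pi.single i 1)
  let E : Fin c → Derivation ℝ (MvPolynomial (Fin n) ℝ) (MvPolynomial (Fin n) ℝ) := fun l =>
    constDerivation fun i => b.coord (Sum.inl l) (Pi.single i 1)
  have hD₀g : ∀ j, eval z (D₀ (g j)) = 0 := fun j => by
    rw [eval_constDerivation_of_linearMap, ← hbl]; simp
  have hD₀x : ∀ i, eval z (D₀ (x i)) = α i := fun i => by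
    rw [eval_constDerivation_of_linearMap, ← hbr]; simp
  have hE : ∀ l j, eval z (E l (g j)) = if j = l then 1 else 0 := fun l j => by
    rw [eval_constDerivation_of_linearMap, ← hbl]; simp [Finsupp.single_apply]
  -- Solving with the adjugate instead of the inverse keeps the coefficients polynomial, so D kills
  -- each g identically. At z the determinant is 1 and the correction vanishes.
  let M : Matrix (Fin c) (Fin c) (MvPolynomial (Fin n) ℝ) := Matrix.of fun j l => E l (g j)
  have hM : M.map (eval z) = 1 := by
    ext j l; simp [M, hE, Matrix.one_apply]
  let r := fun j => D₀ (g j)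
  have happ : ∀ f, (M.det • D₀ - ∑ l, (M.adjugate.mulVec r) l • E l) f =
      M.det * D₀ f - ∑ l, (M.adjugate.mulVec r) l * E l f := by
    intro f
    rw [Derivation.sub_apply, Derivation.smul_apply]
    congr 1
    rw [← Derivation.coeFnAddMonoidHom_apply, map_sum, Finset.sum_apply]; rfl
  refine ⟨M.det • D₀ - ∑ l, (M.adjugate.mulVec r) l • E l, fun j => ?_, fun i => ?_⟩
  · have h : M.mulVec (M.adjugate.mulVec r) j = M.det * r j := by
      rw [Matrix.mulVec_mulVec, Matrix.mul_adjugate, Matrix.smul_mulVec, Matrix.one_mulVec]; rfl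
    rw [happ, ← h, sub_eq_zero]
    change ∑ l, E l (g j) * (M.adjugate.mulVec r) l = _
    exact Finset.sum_congr rfl fun l _ => mul_comm _ _
  · rw [happ, map_sub, map_mul, RingHom.map_det, RingHom.mapMatrix_apply, hM, Matrix.det_one,
      one_mul, hD₀x,
      map_sum, Finset.sum_eq_zero, sub_zero]
    intro l _
    rw [map_mul, Matrix.mulVec, dotProduct, map_sum, Finset.sum_eq_zero, zero_mul]
    intro j _
    rw [map_mul, hD₀g, mul_zero]

/-! ### Taylor coefficients of functions of one variable -/

open Filter

/-- First terms of the Taylor expansion of `h 0`, where `h (k + 1)` is the derivative of `h k`. -/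
lemma tendsto_div_pow_of_hasDerivAt (k : ℕ) : ∀ (h : ℕ → ℝ → ℝ),
    (∀ᶠ t in 𝓝 (0 : ℝ), ∀ j, HasDerivAt (h j) (h (j + 1) t) t) → (∀ j < k, h j 0 = 0) →
    Tendsto (fun t => h 0 t / t ^ k) (𝓝[≠] 0) (𝓝 (h k 0 / k.factorial)) := by
  induction k with
  | zero =>
    intro h hd _
    simpa using (hd.self_of_nhds 0).continuousAt.tendsto.mono_left nhdsWithin_le_nhds
  | succ k ih =>
    intro h hd h0
    have h1 := ih (fun j => h (j + 1)) (hd.mono fun t ht j => ht (j + 1))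
      fun j hj => h0 (j + 1) (by omega)
    have h2 : Tendsto (fun t => h 1 t / ((k + 1 : ℕ) * t ^ k)) (𝓝[≠] 0)
        (𝓝 (h (k + 1) 0 / (k + 1).factorial)) := by
      have := h1.div_const ((k + 1 : ℕ) : ℝ)
      rw [div_div, ← Nat.cast_mul, mul_comm, ← Nat.factorial_succ] at this
      refine this.congr fun t => ?_
      rw [div_div, mul_comm]
    refine HasDerivAt.lhopital_zero_nhdsNE (f' := h 1) (g' := fun t => (k + 1 : ℕ) * t ^ k)
      ((hd.filter_mono nhdsWithin_le_nhds).mono fun t ht => ht 0)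
      (Eventually.of_forall fun t => hasDerivAt_pow (k + 1) t) ?_ ?_ ?_ h2
    · filter_upwards [self_mem_nhdsWithin] with t ht
      exact mul_ne_zero (by positivity) (pow_ne_zero _ ht)
    · have := (hd.self_of_nhds 0).continuousAt.tendsto
      rw [h0 0 (by omega)] at this
      exact this.mono_left nhdsWithin_le_nhds
    · have : Tendsto (fun t : ℝ => t ^ (k + 1)) (𝓝 0) (𝓝 (0 ^ (k + 1))) := tendsto_id.pow _
      rw [zero_pow (by omega)] at this
      exact this.mono_left nhdsWithin_le_nhds

lemma tendsto_div_pow_zero_of_lt {f : ℝ → ℝ} {j k : ℕ} (hjk : j < k) {L : ℝ}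
    (hf : Tendsto (fun t => f t / t ^ k) (𝓝[≠] 0) (𝓝 L)) :
    Tendsto (fun t => f t / t ^ j) (𝓝[≠] 0) (𝓝 0) := by
  have h1 : Tendsto (fun t : ℝ => t ^ (k - j)) (𝓝[≠] 0) (𝓝 0) := by
    have : Tendsto (fun t : ℝ => t ^ (k - j)) (𝓝 0) (𝓝 (0 ^ (k - j))) := tendsto_id.pow _
    rw [zero_pow (by omega)] at this
    exact this.mono_left nhdsWithin_le_nhds
  have h2 := hf.mul h1
  rw [mul_zero] at h2
  refine h2.congr' ?_
  filter_upwards [self_mem_nhdsWithin] with t ht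
  have ht : t ≠ 0 := ht
  obtain ⟨i, rfl⟩ := Nat.exists_eq_add_of_lt hjk
  rw [show j + i + 1 - j = i + 1 by omega, show t ^ (j + i + 1) = t ^ j * t ^ (i + 1) by ring]
  field_simp

/-- No vanishing of lower derivatives is assumed: a finite limit after division by t^k forces each
lower Taylor coefficient to be zero, inductively. -/
lemma eq_of_tendsto_div_pow {h : ℕ → ℝ → ℝ} {k : ℕ} {L : ℝ}
    (hd : ∀ᶠ t in 𝓝 (0 : ℝ), ∀ j, HasDerivAt (h j) (h (j + 1) t) t)
    (hL : Tendsto (fun t => h 0 t / t ^ k) (𝓝[≠] 0) (𝓝 L)) : h k 0 / k.factorial = L := by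
  have h0 : ∀ j, j < k → h j 0 = 0 := by
    intro j
    induction j using Nat.strong_induction_on with
    | _ j ih =>
      intro hj
      have h1 := tendsto_div_pow_of_hasDerivAt j h hd fun i hi => ih i hi (hi.trans hj)
      have h2 := tendsto_nhds_unique h1 (tendsto_div_pow_zero_of_lt hj hL)
      exact (div_eq_zero_iff.1 h2).resolve_right (by positivity)
  exact tendsto_nhds_unique (tendsto_div_pow_of_hasDerivAt k h hd h0) hL

/-! ### Integral curves -/

lemma MvPolynomial.contDiff_eval (f : MvPolynomial (Fin n) ℝ) (m : WithTop ℕ∞) :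
    ContDiff ℝ m fun y : Fin n → ℝ => eval y f := by
  induction f using MvPolynomial.induction_on with
  | C a => simpa using contDiff_const
  | add p q hp hq => simpa using hp.add hq
  | mul_X p i hp => simpa using hp.mul (contDiff_apply ℝ ℝ i)

/-- `γ` is near `0` an integral curve of the polynomial vector field `D`. -/
def IsLocalIntegralCurve
    (D : Derivation ℝ (MvPolynomial (Fin n) ℝ) (MvPolynomial (Fin n) ℝ)) (γ : ℝ → Fin n → ℝ) :
    Prop :=
  ∀ᶠ t in 𝓝 (0 : ℝ), ∀ f, HasDerivAt (fun t => eval (γ t) f) (eval (γ t) (D f)) t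

/-- Picard–Lindelöf gives the equation for the coordinates; the Leibniz rule propagates it to all
polynomials. -/
lemma exists_isLocalIntegralCurve
    (D : Derivation ℝ (MvPolynomial (Fin n) ℝ) (MvPolynomial (Fin n) ℝ)) (v : Fin n → ℝ) :
    ∃ γ : ℝ → Fin n → ℝ, γ 0 = v ∧ IsLocalIntegralCurve D γ := by
  have hX : ContDiff ℝ 1 fun y : Fin n → ℝ => fun i => eval y (D (X i)) :=
    contDiff_pi.2 fun i => MvPolynomial.contDiff_eval _ _
  obtain ⟨γ, h0, ε, hε, hγ⟩ :=
    hX.contDiffAt.exists_forall_mem_closedBall_exists_eq_forall_mem_Ioo_hasDerivAt₀ (x₀ := v) 0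
  refine ⟨γ, h0, ?_⟩
  filter_upwards [Ioo_mem_nhds (show (0 : ℝ) - ε < 0 by linarith) (show 0 < 0 + ε by linarith)]
    with t ht f
  have h := hasDerivAt_pi.1 (hγ t ht)
  induction f using MvPolynomial.induction_on with
  | C a =>
    have : D (C a) = 0 := D.map_algebraMap a
    simpa [this] using hasDerivAt_const t a
  | add p q hp hq => simpa using hp.fun_add hq
  | mul_X p i hp =>
    have := hp.fun_mul (h i)
    simp only [map_mul, eval_X, Derivation.leibniz, smul_eq_mul, map_add]
    exact this.congr_deriv (by ring)

lemma IsLocalIntegralCurve.continuousAt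
    {D : Derivation ℝ (MvPolynomial (Fin n) ℝ) (MvPolynomial (Fin n) ℝ)} {γ : ℝ → Fin n → ℝ}
    (hγ : IsLocalIntegralCurve D γ) : ContinuousAt γ 0 := by
  refine continuousAt_pi.2 fun i => ?_
  simpa using (hγ.self_of_nhds (X i)).continuousAt

lemma IsLocalIntegralCurve.iterate
    {D : Derivation ℝ (MvPolynomial (Fin n) ℝ) (MvPolynomial (Fin n) ℝ)} {γ : ℝ → Fin n → ℝ}
    (hγ : IsLocalIntegralCurve D γ) (f : MvPolynomial (Fin n) ℝ) :
    ∀ᶠ t in 𝓝 (0 : ℝ), ∀ j, HasDerivAt (fun t => eval (γ t) (D^[j] f))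
      (eval (γ t) (D^[j + 1] f)) t := by
  filter_upwards [hγ] with t ht j
  rw [Function.iterate_succ_apply']
  exact ht _

/-- An integral curve of a vector field annihilating local equations of `V` stays in `V`. -/
lemma IsLocalIntegralCurve.eventually_eval_eq_zero
    {D : Derivation ℝ (MvPolynomial (Fin n) ℝ) (MvPolynomial (Fin n) ℝ)} {γ : ℝ → Fin n → ℝ}
    (hγ : IsLocalIntegralCurve D γ) {c : ℕ} {g : Fin c → MvPolynomial (Fin n) ℝ}
    {s : MvPolynomial (Fin n) ℝ} (hD : ∀ j, D (g j) = 0)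
    (hgI : ∀ j, g j ∈ vanishingIdeal ℝ V)
    (hs : ∀ f ∈ vanishingIdeal ℝ V, s * f ∈ Ideal.span (Set.range g))
    (h0 : γ 0 ∈ V) (hs0 : eval (γ 0) s ≠ 0) :
    ∀ᶠ t in 𝓝 (0 : ℝ), ∀ f ∈ vanishingIdeal ℝ V, eval (γ t) f = 0 := by
  obtain ⟨ε, hε, hball⟩ := Metric.eventually_nhds_iff_ball.1 hγ
  have hg : ∀ t ∈ Metric.ball (0 : ℝ) ε, ∀ j, eval (γ t) (g j) = 0 := by
    intro t ht j
    have hd : ∀ u ∈ Metric.ball (0 : ℝ) ε, HasDerivAt (fun t => eval (γ t) (g j)) 0 u := by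
      intro u hu
      have := hball u hu (g j)
      rwa [hD, map_zero] at this
    have := Metric.isOpen_ball.is_const_of_deriv_eq_zero (convex_ball (0 : ℝ) ε).isPreconnected
      (fun u hu => (hd u hu).differentiableAt.differentiableWithinAt)
      (fun u hu => (hd u hu).deriv) ht (Metric.mem_ball_self hε)
    exact this.trans (eval_eq_zero_of_mem_vanishingIdeal (hgI j) h0)
  have hsγ : ∀ᶠ t in 𝓝 (0 : ℝ), eval (γ t) s ≠ 0 :=
    (hγ.self_of_nhds s).continuousAt.eventually_ne hs0
  -- The g are constant, hence zero, along the curve, so s · f vanishes there too, and s stays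
  -- nonzero for small t.
  filter_upwards [hsγ, Metric.ball_mem_nhds (0 : ℝ) hε] with t ht htb f hf
  have hle : Ideal.span (Set.range g) ≤ RingHom.ker (eval (γ t)) := by
    rw [Ideal.span_le]
    rintro _ ⟨j, rfl⟩
    exact hg t htb j
  have := hle (hs f hf)
  rw [RingHom.mem_ker, map_mul] at this
  exact (mul_eq_zero.1 this).resolve_left ht

/-- If `F` is continuous on `V` and `F = P / Q` on `V ∩ {Q ≠ 0}`, then `F` is the quotient of the
leading Taylor coefficients of `P` and `Q` along any vector field tangent to `V`. -/
theorem mul_iterate_eq_of_continuousOn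
    (hV : ∀ y, (∀ f ∈ vanishingIdeal ℝ V, eval y f = 0) → y ∈ V)
    {D : Derivation ℝ (MvPolynomial (Fin n) ℝ) (MvPolynomial (Fin n) ℝ)}
    {c : ℕ} {g : Fin c → MvPolynomial (Fin n) ℝ}
    {s : MvPolynomial (Fin n) ℝ} (hD : ∀ j, D (g j) = 0)
    (hgI : ∀ j, g j ∈ vanishingIdeal ℝ V)
    (hs : ∀ f ∈ vanishingIdeal ℝ V, s * f ∈ Ideal.span (Set.range g))
    {F : (Fin n → ℝ) → ℝ} (hF : ContinuousOn F V) {P Q : MvPolynomial (Fin n) ℝ}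
    (hPQ : ∀ y ∈ V, eval y Q ≠ 0 → F y * eval y Q = eval y P)
    {v : Fin n → ℝ} (hv : v ∈ V) (hsv : eval v s ≠ 0) {k : ℕ}
    (hQ0 : ∀ j < k, eval v (D^[j] Q) = 0) (hQk : eval v (D^[k] Q) ≠ 0) :
    F v * eval v (D^[k] Q) = eval v (D^[k] P) := by
  obtain ⟨γ, rfl, hγ⟩ := exists_isLocalIntegralCurve D v
  have hγV : ∀ᶠ t in 𝓝 (0 : ℝ), γ t ∈ V :=
    (hγ.eventually_eval_eq_zero hD hgI hs hv hsv).mono fun t ht => hV _ ht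
  have hFγ : Tendsto (fun t => F (γ t)) (𝓝 0) (𝓝 (F (γ 0))) :=
    (hF (γ 0) hv).tendsto.comp (tendsto_nhdsWithin_iff.2 ⟨hγ.continuousAt.tendsto, hγV⟩)
  have hQ := tendsto_div_pow_of_hasDerivAt k (fun j t => eval (γ t) (D^[j] Q)) (hγ.iterate Q) hQ0
  have hQne : eval (γ 0) (D^[k] Q) / (k.factorial : ℝ) ≠ 0 := div_ne_zero hQk (by positivity)
  -- Since Q(γ t)/t^k has a nonzero limit, Q(γ t) ≠ 0 for small t ≠ 0, so P = F · Q holds on the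
  -- punctured curve even if Q vanishes at its origin.
  have hP : Tendsto (fun t => eval (γ t) P / t ^ k) (𝓝[≠] 0)
      (𝓝 (F (γ 0) * (eval (γ 0) (D^[k] Q) / k.factorial))) := by
    refine ((hFγ.mono_left nhdsWithin_le_nhds).mul hQ).congr' ?_
    filter_upwards [hQ.eventually_ne hQne, hγV.filter_mono nhdsWithin_le_nhds] with t ht htV
    rw [← hPQ _ htV fun h => ht (by simp [h]), mul_div_assoc]
    rfl
  have := eq_of_tendsto_div_pow (h := fun j t => eval (γ t) (D^[j] P)) (hγ.iterate P) hP
  field_simp at this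
  exact this.symm

/-! ### Order of vanishing and initial forms -/

/-- Krull's intersection theorem at a point of an affine variety. -/
lemma exists_mul_mem_of_forall_mem_pow_sup {z : Fin n → ℝ} {I : Ideal (MvPolynomial (Fin n) ℝ)}
    {Q : MvPolynomial (Fin n) ℝ} (hQ : ∀ k, Q ∈ RingHom.ker (eval z) ^ k ⊔ I) :
    ∃ u, eval z u ≠ 0 ∧ u * Q ∈ I := by
  have h1 : Ideal.Quotient.mk I Q ∈ (⨅ i : ℕ, RingHom.ker (eval z) ^ i •
      ⊤ : Submodule (MvPolynomial (Fin n) ℝ) (MvPolynomial (Fin n) ℝ ⧸ I)) := by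
    rw [Submodule.mem_iInf]
    intro k
    obtain ⟨a, ha, b, hb, rfl⟩ := Submodule.mem_sup.1 (hQ k)
    have : Ideal.Quotient.mk I (a + b) = a • (1 : MvPolynomial (Fin n) ℝ ⧸ I) := by
      rw [map_add, Ideal.Quotient.eq_zero_iff_mem.2 hb, add_zero]
      exact congrArg (Ideal.Quotient.mk I) (mul_one a).symm
    rw [this]
    exact Submodule.smul_mem_smul ha Submodule.mem_top
  obtain ⟨⟨r, hr⟩, h⟩ := (Ideal.mem_iInf_smul_pow_eq_bot_iff (RingHom.ker (eval z)) _).1 h1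
  refine ⟨1 - r, by rw [map_sub, (RingHom.mem_ker).1 hr]; simp, ?_⟩
  have h' : Ideal.Quotient.mk I (r * Q) = Ideal.Quotient.mk I Q := by
    exact h
  rw [← Ideal.Quotient.eq_zero_iff_mem, sub_mul, one_mul, map_sub, h', sub_self]

/-- Modulo I and higher order, every polynomial of order k at z is a degree-k form in the
parameters. This supplies the initial form of a denominator. -/
lemma ker_eval_pow_le {e : ℕ} {z : Fin n → ℝ} {I : Ideal (MvPolynomial (Fin n) ℝ)}
    {x : Fin e → MvPolynomial (Fin n) ℝ} (hx : ∀ i, eval z (x i) = 0)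
    (h : RingHom.ker (eval z) ≤ I ⊔ Ideal.span (Set.range x) ⊔ RingHom.ker (eval z) ^ 2) (k : ℕ) :
    RingHom.ker (eval z) ^ k ≤
      Ideal.span (Set.range x) ^ k ⊔ I ⊔ RingHom.ker (eval z) ^ (k + 1) := by
  have hxn : Ideal.span (Set.range x) ≤ RingHom.ker (eval z) :=
    Ideal.span_le.2 (Set.range_subset_iff.2 hx)
  induction k with
  | zero => simp
  | succ k ih =>
    rw [pow_succ, Ideal.mul_le]
    intro a ha b hb
    obtain ⟨a', ha', a3, ha3, rfl⟩ := Submodule.mem_sup.1 (ih ha)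
    obtain ⟨a1, ha1, a2, ha2, rfl⟩ := Submodule.mem_sup.1 ha'
    have ha1n : a1 ∈ RingHom.ker (eval z) ^ k := Ideal.pow_right_mono hxn k ha1
    obtain ⟨b', hb', b3, hb3, rfl⟩ := Submodule.mem_sup.1 (h hb)
    obtain ⟨b1, hb1, b2, hb2, rfl⟩ := Submodule.mem_sup.1 hb'
    have e1 : a1 * b2 ∈ Ideal.span (Set.range x) ^ (k + 1) := by
      rw [pow_succ]; exact Ideal.mul_mem_mul ha1 hb2
    have e2 : a2 * (b1 + b2 + b3) + a1 * b1 ∈ I :=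
      add_mem (Ideal.mul_mem_right _ _ ha2) (Ideal.mul_mem_left _ _ hb1)
    have e3 : a1 * b3 + a3 * (b1 + b2 + b3) ∈ RingHom.ker (eval z) ^ (k + 1 + 1) := by
      refine add_mem ?_ ?_
      · rw [add_assoc, pow_add]; exact Ideal.mul_mem_mul ha1n hb3
      · rw [pow_succ]; exact Ideal.mul_mem_mul ha3 hb
    have : (a1 + a2 + a3) * (b1 + b2 + b3) =
      a1 * b2 + (a2 * (b1 + b2 + b3) + a1 * b1) + (a1 * b3 + a3 * (b1 + b2 + b3)) := by ring
    rw [this]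
    exact Submodule.add_mem_sup (Submodule.add_mem_sup e1 e2) e3

lemma IsLocalIntegralCurve.tendsto_div
    {D : Derivation ℝ (MvPolynomial (Fin n) ℝ) (MvPolynomial (Fin n) ℝ)} {γ : ℝ → Fin n → ℝ}
    (hγ : IsLocalIntegralCurve D γ) {f : MvPolynomial (Fin n) ℝ} (hf : eval (γ 0) f = 0) :
    Tendsto (fun t => eval (γ t) f / t) (𝓝[≠] 0) (𝓝 (eval (γ 0) (D f))) := by
  simpa using tendsto_div_pow_of_hasDerivAt 1 (fun j t => eval (γ t) (D^[j] f)) (hγ.iterate f)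
    (by simpa using hf)

/-- Each factor vanishing at the origin of the curve absorbs one division by t. -/
lemma IsLocalIntegralCurve.exists_tendsto_div_pow
    {D : Derivation ℝ (MvPolynomial (Fin n) ℝ) (MvPolynomial (Fin n) ℝ)} {γ : ℝ → Fin n → ℝ}
    (hγ : IsLocalIntegralCurve D γ) {k : ℕ} {f : MvPolynomial (Fin n) ℝ}
    (hf : f ∈ RingHom.ker (eval (γ 0)) ^ k) :
    ∃ L, Tendsto (fun t => eval (γ t) f / t ^ k) (𝓝[≠] 0) (𝓝 L) := by
  induction k generalizing f with
  | zero =>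
    refine ⟨eval (γ 0) f, ?_⟩
    simpa using (hγ.self_of_nhds f).continuousAt.tendsto.mono_left nhdsWithin_le_nhds
  | succ k ih =>
    rw [pow_succ] at hf
    refine Submodule.mul_induction_on hf ?_ ?_
    · intro a ha b hb
      obtain ⟨L, hL⟩ := ih ha
      refine ⟨_, (hL.mul (hγ.tendsto_div hb)).congr fun t => ?_⟩
      rw [map_mul, pow_succ, mul_div_mul_comm]
    · rintro a b ⟨L, hL⟩ ⟨L', hL'⟩
      refine ⟨_, (hL.add hL').congr fun t => ?_⟩
      rw [map_add, add_div]

/-- Along the curve x i / t tends to the derivative of x i at the origin, and a monomial of degree k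
uses up exactly k divisions by t. -/
lemma IsLocalIntegralCurve.tendsto_eval_homogeneous
    {D : Derivation ℝ (MvPolynomial (Fin n) ℝ) (MvPolynomial (Fin n) ℝ)} {γ : ℝ → Fin n → ℝ}
    (hγ : IsLocalIntegralCurve D γ) {e k : ℕ} {x : Fin e → MvPolynomial (Fin n) ℝ}
    (hx : ∀ i, eval (γ 0) (x i) = 0) {F : MvPolynomial (Fin e) (MvPolynomial (Fin n) ℝ)}
    (hF : F.IsHomogeneous k) :
    Tendsto (fun t => eval (γ t) (eval x F) / t ^ k) (𝓝[≠] 0)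
      (𝓝 (eval (fun i => eval (γ 0) (D (x i))) (map (eval (γ 0)) F))) := by
  have h1 : eval (fun i => eval (γ 0) (D (x i))) (map (eval (γ 0)) F) =
      ∑ d ∈ F.support, eval (γ 0) (coeff d F) * ∏ i, eval (γ 0) (D (x i)) ^ d i := by
    rw [eval_map, eval₂_eq']
  rw [h1]
  have h2 : Tendsto (fun t => ∑ d ∈ F.support, eval (γ t) (coeff d F) *
      ∏ i, (eval (γ t) (x i) / t) ^ d i) (𝓝[≠] 0)
      (𝓝 (∑ d ∈ F.support, eval (γ 0) (coeff d F) * ∏ i, eval (γ 0) (D (x i)) ^ d i)) := by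
    refine tendsto_finsetSum _ fun d _ => Tendsto.mul ?_ (tendsto_finsetProd _ fun i _ => ?_)
    · exact (hγ.self_of_nhds _).continuousAt.tendsto.mono_left nhdsWithin_le_nhds
    · exact (hγ.tendsto_div (hx i)).pow _
  refine h2.congr fun t => ?_
  rw [eval_eq' x F, map_sum, Finset.sum_div]
  refine Finset.sum_congr rfl fun d hd => ?_
  have hdeg : ∑ i, d i = k := by
    rw [← Finsupp.degree_eq_sum]
    exact (Finsupp.degree_eq_weight_one (R := ℕ)).symm ▸ hF (mem_support_iff.1 hd)
  simp only [div_pow, Finset.prod_div_distrib, Finset.prod_pow_eq_pow_sum, hdeg, map_mul, map_prod,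
    map_pow, mul_div_assoc]

/-- If `Q` is nonzero in the local ring of `V` at `z`, then some iterated derivative of `Q` along
a polynomial vector field tangent to the `g j` is nonzero at `z`. -/
theorem exists_iterate_derivation_ne_zero {c e : ℕ} {z : Fin n → ℝ} (hz : z ∈ V)
    {g : Fin c → MvPolynomial (Fin n) ℝ} {x : Fin e → MvPolynomial (Fin n) ℝ}
    {s : MvPolynomial (Fin n) ℝ} (b : Module.Basis (Fin c ⊕ Fin e) ℝ (Fin n → ℝ))
    (hgI : ∀ j, g j ∈ vanishingIdeal ℝ V) (hx : ∀ i, eval z (x i) = 0) (hs0 : eval z s ≠ 0)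
    (hs : ∀ f ∈ vanishingIdeal ℝ V, s * f ∈ Ideal.span (Set.range g))
    (hbl : ∀ j, b (Sum.inl j) = gradAt z (g j)) (hbr : ∀ i, b (Sum.inr i) = gradAt z (x i))
    {Q : MvPolynomial (Fin n) ℝ} (hQ : ∀ u, eval z u ≠ 0 → u * Q ∉ vanishingIdeal ℝ V) :
    ∃ D : Derivation ℝ (MvPolynomial (Fin n) ℝ) (MvPolynomial (Fin n) ℝ),
      (∀ j, D (g j) = 0) ∧ ∃ k, eval z (D^[k] Q) ≠ 0 := by
  classical
  have hgle : Ideal.span (Set.range g) ≤ vanishingIdeal ℝ V :=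
    Ideal.span_le.2 (Set.range_subset_iff.2 hgI)
  have hcot := (le_span_sup_sq_of_basis
    (fun j => eval_eq_zero_of_mem_vanishingIdeal (hgI j) hz) hx b hbl hbr).trans
      (sup_le_sup_right (sup_le_sup_right hgle _) _)
  -- k is the order of Q at z along V, finite by Krull because Q is nonzero in the local ring.
  obtain ⟨k, hk, hk1⟩ : ∃ k, Q ∈ RingHom.ker (eval z) ^ k ⊔ vanishingIdeal ℝ V ∧
      Q ∉ RingHom.ker (eval z) ^ (k + 1) ⊔ vanishingIdeal ℝ V := by
    by_contra! hcon
    have : ∀ k, Q ∈ RingHom.ker (eval z) ^ k ⊔ vanishingIdeal ℝ V := by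
      intro k
      induction k with
      | zero => simp
      | succ k ih => exact hcon k ih
    obtain ⟨u, hu, h⟩ := exists_mul_mem_of_forall_mem_pow_sup this
    exact hQ u hu h
  obtain ⟨q, hq, i₁, hi₁, rfl⟩ := Submodule.mem_sup.1 hk
  obtain ⟨q', hq', r, hr, rfl⟩ := Submodule.mem_sup.1 (ker_eval_pow_le hx hcot k hq)
  obtain ⟨p, hp, i₂, hi₂, rfl⟩ := Submodule.mem_sup.1 hq'
  obtain ⟨F, hF, rfl⟩ := (Ideal.mem_span_pow_iff_exists_isHomogeneous x p).1 hp
  -- If all coefficients of the form vanished at z, Q would have order greater than k.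
  have hFz : map (eval z) F ≠ 0 := by
    intro h0
    apply hk1
    have h1 : eval x F ∈ RingHom.ker (eval z) ^ (k + 1) := by
      rw [eval_eq']
      refine Ideal.sum_mem _ fun d hd => ?_
      have hdeg : ∑ i, d i = k := by
        rw [← Finsupp.degree_eq_sum]
        exact (Finsupp.degree_eq_weight_one (R := ℕ)).symm ▸ hF (mem_support_iff.1 hd)
      rw [pow_succ', ← hdeg, ← Finset.prod_pow_eq_pow_sum]
      refine Ideal.mul_mem_mul ?_ (Ideal.prod_mem_prod fun i _ => Ideal.pow_mem_pow (hx i) _)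
      rw [RingHom.mem_ker, ← coeff_map, h0, coeff_zero]
    have : eval x F + i₂ + r + i₁ = (eval x F + r) + (i₂ + i₁) := by ring
    rw [this]
    exact Submodule.add_mem_sup (add_mem h1 hr) (add_mem hi₂ hi₁)
  obtain ⟨α, hα⟩ : ∃ α, eval α (map (eval z) F) ≠ 0 := by
    by_contra! h
    exact hFz (MvPolynomial.funext fun α => by simpa using h α)
  obtain ⟨D, hDg, hDx⟩ := exists_tangent_derivation z g x b hbl hbr α
  refine ⟨D, hDg, ?_⟩
  -- Along the integral curve Q/t^k tends to the initial form at α, which is nonzero; if all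
  -- iterated derivatives vanished at z, this limit would be 0.
  by_contra! hcon
  obtain ⟨γ, rfl, hγ⟩ := exists_isLocalIntegralCurve D z
  have h1 := hγ.tendsto_eval_homogeneous hx hF
  rw [show (fun i => eval (γ 0) (D (x i))) = α from _root_.funext hDx] at h1
  obtain ⟨L, hL⟩ := hγ.exists_tendsto_div_pow hr
  have h2 := h1.add (tendsto_div_pow_zero_of_lt (Nat.lt_succ_self k) hL)
  have h3 := tendsto_div_pow_of_hasDerivAt k
    (fun j t => eval (γ t) (D^[j] (eval x F + i₂ + r + i₁))) (hγ.iterate _) fun j _ => hcon j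
  have h4 := tendsto_nhds_unique (h2.congr' ?_) h3
  · rw [hcon k, zero_div, add_zero] at h4
    exact hα h4
  · filter_upwards [(hγ.eventually_eval_eq_zero hDg hgI hs hz hs0).filter_mono
      nhdsWithin_le_nhds] with t ht
    simp [ht _ hi₁, ht _ hi₂, add_div]

/-! ### Zariski topology, charts and regular functions -/

lemma isOpen_realZariski_iff {n : ℕ} {U : Set (Fin n → ℝ)} :
    IsOpen[realZariski n] U ↔
      ∀ y ∈ U, ∃ f : MvPolynomial (Fin n) ℝ, eval y f ≠ 0 ∧ ∀ y', eval y' f ≠ 0 → y' ∈ U := by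
  constructor
  · rintro ⟨I, hI⟩ y hy
    have hy' : y ∉ zeroLocus ℝ I := hI ▸ fun h => h hy
    simp only [mem_zeroLocus_iff, not_forall, aeval_eq_eval] at hy'
    obtain ⟨f, hf, hfy⟩ := hy'
    refine ⟨f, hfy, fun y' h => ?_⟩
    by_contra hU
    have : y' ∈ zeroLocus ℝ I := hI ▸ hU
    exact h (by simpa [aeval_eq_eval] using this f hf)
  · intro h
    refine ⟨vanishingIdeal ℝ Uᶜ, ?_⟩
    ext y
    constructor
    · intro hy f hf
      exact hf y hy
    · intro hy hyU
      obtain ⟨f, hf, hfU⟩ := h y hyU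
      refine hf ?_
      have : f ∈ vanishingIdeal ℝ Uᶜ := fun y' hy' => by
        rw [aeval_eq_eval]
        by_contra hne
        exact hy' (hfU y' hne)
      simpa [aeval_eq_eval] using hy f this

lemma mem_of_isClosed_realZariski {n : ℕ} {V : Set (Fin n → ℝ)} (hV : IsClosed[realZariski n] V)
    {y : Fin n → ℝ} (hy : ∀ f ∈ vanishingIdeal ℝ V, eval y f = 0) : y ∈ V := by
  by_contra h
  obtain ⟨f, hf, hfV⟩ := isOpen_realZariski_iff.1 hV.isOpen_compl y h
  refine hf (hy f fun y' hy' => ?_)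
  rw [aeval_eq_eval]
  by_contra hne
  exact hfV y' hne hy'

/-- Clearing denominators in the substitution of the fractions `p k / q k` into a polynomial. -/
lemma exists_clear_denominators {m n : ℕ} (p q : Fin m → MvPolynomial (Fin n) ℝ)
    (f : MvPolynomial (Fin m) ℝ) :
    ∃ (F : MvPolynomial (Fin n) ℝ) (N : ℕ), ∀ y, eval y (∏ k, q k) ≠ 0 →
      eval y F = eval y (∏ k, q k) ^ N * eval (fun k => eval y (p k) / eval y (q k)) f := by
  classical
  induction f using MvPolynomial.induction_on with
  | C a => exact ⟨C a, 0, by simp⟩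
  | add f g hf hg =>
    obtain ⟨F, N, hF⟩ := hf
    obtain ⟨G, M, hG⟩ := hg
    refine ⟨F * (∏ k, q k) ^ M + G * (∏ k, q k) ^ N, N + M, fun y hy => ?_⟩
    rw [map_add, map_mul, map_mul, map_pow, map_pow, hF y hy, hG y hy, map_add]
    ring
  | mul_X f i hf =>
    obtain ⟨F, N, hF⟩ := hf
    refine ⟨F * (p i * ∏ k ∈ Finset.univ.erase i, q k), N + 1, fun y hy => ?_⟩
    have h1 := Finset.mul_prod_erase Finset.univ q (Finset.mem_univ i)
    rw [map_mul, hF y hy, map_mul, map_mul, eval_X, pow_succ]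
    rw [← h1, map_mul] at hy ⊢
    have := left_ne_zero_of_mul hy
    field_simp

namespace RealAlgebraicVariety

variable {X : RealAlgebraicVariety}

lemma isOpen_zariski_iff {O : Set X.carrier} :
    IsOpen[X.zariski] O ↔ ∀ i (v : X.model i), X.chart i v ∈ O →
      ∃ f : MvPolynomial (Fin (X.dim i)) ℝ, eval v.1 f ≠ 0 ∧
        ∀ w : X.model i, eval w.1 f ≠ 0 → X.chart i w ∈ O := by
  rw [isOpen_iSup_iff]
  refine forall_congr' fun i => ?_
  rw [isOpen_coinduced, @isOpen_induced_iff _ _ (realZariski (X.dim i))]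
  constructor
  · rintro ⟨U, hU, hUO⟩ v hv
    have hvU : v.1 ∈ U := by
      change v ∈ Subtype.val ⁻¹' U
      rw [hUO]; exact hv
    obtain ⟨f, hf, hfU⟩ := isOpen_realZariski_iff.1 hU _ hvU
    refine ⟨f, hf, fun w hw => ?_⟩
    change w ∈ X.chart i ⁻¹' O
    rw [← hUO]
    exact hfU _ hw
  · intro h
    refine ⟨{y | ∃ f, eval y f ≠ 0 ∧ ∀ w : X.model i, eval w.1 f ≠ 0 → X.chart i w ∈ O}, ?_, ?_⟩
    · refine isOpen_realZariski_iff.2 ?_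
      rintro y ⟨f, hf, hfO⟩
      exact ⟨f, hf, fun y' hy' => ⟨f, hy', hfO⟩⟩
    · ext v
      exact ⟨fun ⟨f, hf, hfO⟩ => hfO v hf, fun hv => h v hv⟩

/-- Near a point of an overlap, polynomials in one chart are quotients of polynomials in the
other. -/
lemma exists_transition (i j : Fin X.numCharts) (v : X.model i) (w : X.model j)
    (hvw : X.chart i v = X.chart j w) :
    ∃ q : MvPolynomial (Fin (X.dim i)) ℝ, eval v.1 q ≠ 0 ∧
      (∀ v', eval v'.1 q ≠ 0 → X.chart i v' ∈ Set.range (X.chart j)) ∧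
      ∀ f : MvPolynomial (Fin (X.dim j)) ℝ, ∃ F G : MvPolynomial (Fin (X.dim i)) ℝ,
        (∀ v', eval v' q ≠ 0 → eval v' G ≠ 0) ∧ ∀ v' w', X.chart i v' = X.chart j w' →
          eval v'.1 q ≠ 0 → eval v'.1 F = eval v'.1 G * eval w'.1 f := by
  choose p q hq hpq using X.transition_regular i j v w hvw
  obtain ⟨O, hO, hOr⟩ := X.overlap_open i j
  obtain ⟨h, hh, hhO⟩ := isOpen_realZariski_iff.1 hO v.1 ((hOr v).1 ⟨w, hvw.symm⟩)
  refine ⟨h * ∏ k, q k, ?_, fun v' hv' => ?_, fun f => ?_⟩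
  · rw [map_mul, map_prod]
    exact mul_ne_zero hh (Finset.prod_ne_zero_iff.2 fun k _ => hq k)
  · rw [map_mul] at hv'
    exact (hOr v').2 (hhO _ (left_ne_zero_of_mul hv'))
  · obtain ⟨F, N, hF⟩ := exists_clear_denominators p q f
    refine ⟨F, (∏ k, q k) ^ N, fun v' hv' => ?_, fun v' w' hvw' hv' => ?_⟩
    · rw [map_mul] at hv'
      rw [map_pow]
      exact pow_ne_zero _ (right_ne_zero_of_mul hv')
    · rw [map_mul] at hv'
      rw [hF _ (right_ne_zero_of_mul hv'), map_pow]
      congr 3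
      ext k
      refine (hpq k v' w' hvw' ?_).symm
      have := right_ne_zero_of_mul hv'
      rw [map_prod] at this
      exact Finset.prod_ne_zero_iff.1 this k (Finset.mem_univ k)

/-- In another chart, f becomes locally a fraction; its numerator times the overlap denominator
defines a basic neighbourhood. -/
lemma isOpen_chart_image (i : Fin X.numCharts) (f : MvPolynomial (Fin (X.dim i)) ℝ) :
    IsOpen[X.zariski] (X.chart i '' {v | eval v.1 f ≠ 0}) := by
  rw [isOpen_zariski_iff]
  rintro j w ⟨v, hv, hvw⟩
  obtain ⟨q, hq, hqr, hqf⟩ := exists_transition j i w v hvw.symm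
  obtain ⟨F, G, hG, hF⟩ := hqf f
  refine ⟨q * F, ?_, fun w' hw' => ?_⟩
  · rw [map_mul, hF w v hvw.symm hq]
    exact mul_ne_zero hq (mul_ne_zero (hG _ hq) hv)
  · rw [map_mul] at hw'
    obtain ⟨v', hv'⟩ := hqr w' (left_ne_zero_of_mul hw')
    refine ⟨v', ?_, hv'⟩
    have := right_ne_zero_of_mul hw'
    rw [hF w' v' hv'.symm (left_ne_zero_of_mul hw')] at this
    exact right_ne_zero_of_mul this

/-- A regular function on an open set is locally a quotient of polynomials in any given chart. -/
lemma PartialRegular.exists_quotient (a : X.PartialRegular) (i : Fin X.numCharts) (v : X.model i)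
    (hv : X.chart i v ∈ a.domain) :
    ∃ P Q : MvPolynomial (Fin (X.dim i)) ℝ, eval v.1 Q ≠ 0 ∧
      ∀ w : X.model i, eval w.1 Q ≠ 0 →
        X.chart i w ∈ a.domain ∧ a.toFun (X.chart i w) * eval w.1 Q = eval w.1 P := by
  obtain ⟨j, u, hu, p, q, hq, hpq⟩ := a.regular _ hv
  obtain ⟨r, hr, hrr, hrf⟩ := exists_transition i j v u hu.symm
  obtain ⟨F₁, G₁, hG₁, hF₁⟩ := hrf p
  obtain ⟨F₂, G₂, hG₂, hF₂⟩ := hrf q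
  obtain ⟨h, hh, hhO⟩ := isOpen_zariski_iff.1 a.isOpen_domain i v hv
  -- The common factor h · r leaves the fraction unchanged but confines the nonvanishing locus to
  -- the domain and to the overlap of the charts.
  refine ⟨F₁ * G₂ * (h * r), F₂ * G₁ * (h * r), ?_, fun w hw => ?_⟩
  · simp only [map_mul, hF₂ v u hu.symm hr]
    exact mul_ne_zero (mul_ne_zero (mul_ne_zero (hG₂ _ hr) hq) (hG₁ _ hr)) (mul_ne_zero hh hr)
  · simp only [map_mul] at hw
    have hw1 := right_ne_zero_of_mul (right_ne_zero_of_mul hw)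
    have hdom := hhO w (left_ne_zero_of_mul (right_ne_zero_of_mul hw))
    refine ⟨hdom, ?_⟩
    obtain ⟨w', hw'⟩ := hrr w hw1
    have hF₂w := hF₂ w w' hw'.symm hw1
    have hq0 : eval w'.1 q ≠ 0 := by
      have := left_ne_zero_of_mul (left_ne_zero_of_mul hw)
      rw [hF₂w] at this
      exact right_ne_zero_of_mul this
    have hval := hpq w' (hw' ▸ hdom) hq0
    rw [hw'] at hval
    simp only [map_mul]
    rw [hval, hF₂w, hF₁ w w' hw'.symm hw1]
    field_simp

/-- A function that agrees with a regular function on a dense open set is, in the chart `i`, a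
quotient of polynomials whose denominator is nonzero in the local ring at `z`. -/
lemma PartialRegular.exists_denominator (a : X.PartialRegular) (i : Fin X.numCharts)
    (z : X.model i) :
    ∃ P Q : MvPolynomial (Fin (X.dim i)) ℝ,
      (∀ u, eval z.1 u ≠ 0 → u * Q ∉ vanishingIdeal ℝ (X.model i)) ∧
      ∀ w : X.model i, eval w.1 Q ≠ 0 →
        X.chart i w ∈ a.domain ∧ a.toFun (X.chart i w) * eval w.1 Q = eval w.1 P := by
  -- This s kills on the whole model every polynomial with zero germ at z. A denominator that is
  -- nonzero at some point of {s ≠ 0} therefore has nonzero germ at z, even if z is outside the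
  -- domain.
  obtain ⟨s, hs0, hs⟩ := exists_uniform_multiplier (z := z.1)
    (I := RingHom.ker (toAffineLocalRing z)) (J := vanishingIdeal ℝ (X.model i))
    fun f hf => (toAffineLocalRing_eq_zero_iff z f).1 hf
  obtain ⟨_, ⟨v, hv, rfl⟩, hvd⟩ := @Dense.inter_open_nonempty _ X.zariski _ a.dense_domain _
    (isOpen_chart_image i s) ⟨_, z, hs0, rfl⟩
  obtain ⟨P, Q, hQ, hPQ⟩ := a.exists_quotient i v hvd
  refine ⟨P, Q, fun u hu huQ => ?_, hPQ⟩
  have h1 := hs Q ((toAffineLocalRing_eq_zero_iff z Q).2 ⟨u, hu, huQ⟩)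
  have h2 := eval_eq_zero_of_mem_vanishingIdeal h1 v.2
  rw [map_mul] at h2
  exact mul_ne_zero hv hQ h2

lemma continuous_comp_chart {g : X.carrier → ℝ} (hg : @Continuous _ _ X.euclidean _ g)
    (i : Fin X.numCharts) : Continuous (g ∘ X.chart i) :=
  continuous_coinduced_dom.1 (continuous_iSup_dom.1 hg i)

lemma isDenseOpenIn_inter {Z O : Set X.carrier} (hZ : X.IsIrreducibleSubvariety Z)
    (hO : IsOpen[X.zariski] O) (hne : (Z ∩ O).Nonempty) : X.IsDenseOpenIn (Z ∩ O) Z := by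
  refine ⟨⟨O, hO, rfl⟩, fun x hx => ?_⟩
  refine (@mem_closure_iff _ X.zariski _ _).2 fun U hU hxU => ?_
  obtain ⟨y, hyZ, hyU, hyO⟩ := hZ.2.2 U O hU hO ⟨x, hx, hxU⟩ hne
  exact ⟨y, hyU, hyZ, hyO⟩

/-! ### Generic regularity on `Z` -/

/-- A continuous extension of a rational function is generically regular on every irreducible
subvariety that is not contained in the singular locus. -/
theorem exists_isDenseOpenIn_isRegularOn {Z : Set X.carrier} (hZ : X.IsIrreducibleSubvariety Z)
    (hsing : ¬ Z ⊆ X.singularLocus) {f : X.RationalFunction} {fc : X.carrier → ℝ}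
    (hfc : IsContinuousExtension f fc) :
    ∃ Z₀ : Set X.carrier, X.IsDenseOpenIn Z₀ Z ∧ X.IsRegularOn fc Z₀ := by
  classical
  obtain ⟨x₀, hx₀Z, hx₀⟩ := Set.not_subset.1 hsing
  obtain ⟨i, z, rfl, hreg⟩ := not_not.1 hx₀
  obtain ⟨c, e, g, x, s, b, hgI, hx, hs0, hs, hbl, hbr⟩ := exists_local_equations z hreg
  obtain ⟨a, rfl⟩ := Quotient.exists_rep f
  obtain ⟨P, Q, hQ, hPQ⟩ := a.exists_denominator i z
  obtain ⟨D, hD, hDQ⟩ := exists_iterate_derivation_ne_zero z.2 b hgI hx hs0 hs hbl hbr hQ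
  -- The least k is taken over all points of Z with s ≠ 0 at once, so the lower derivatives of Q
  -- vanish at all of them and one formula serves throughout.
  have hex : ∃ k, ∃ v : X.model i, X.chart i v ∈ Z ∧ eval v.1 s ≠ 0 ∧ eval v.1 (D^[k] Q) ≠ 0 := by
    obtain ⟨k, hk⟩ := hDQ
    exact ⟨k, z, hx₀Z, hs0, hk⟩
  obtain ⟨v₀, hv₀Z, hv₀s, hv₀Q⟩ := Nat.find_spec hex
  have hmin : ∀ j < Nat.find hex, ∀ v : X.model i, X.chart i v ∈ Z → eval v.1 s ≠ 0 →
      eval v.1 (D^[j] Q) = 0 := by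
    intro j hj v hvZ hvs
    by_contra hne
    exact Nat.find_min hex hj ⟨v, hvZ, hvs, hne⟩
  generalize Nat.find hex = k at hv₀Q hmin
  have hF : ContinuousOn (fun y => if h : y ∈ X.model i then fc (X.chart i ⟨y, h⟩) else 0)
      (X.model i) := by
    rw [continuousOn_iff_continuous_domRestrict]
    refine (continuous_comp_chart hfc.1 i).congr fun v => ?_
    simp
  have key : ∀ v : X.model i, X.chart i v ∈ Z → eval v.1 s ≠ 0 → eval v.1 (D^[k] Q) ≠ 0 →
      fc (X.chart i v) * eval v.1 (D^[k] Q) = eval v.1 (D^[k] P) := by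
    intro v hvZ hvs hvQ
    have := mul_iterate_eq_of_continuousOn (fun y => mem_of_isClosed_realZariski (X.model_closed i))
      hD hgI hs hF (P := P) (Q := Q) (fun y hy hyQ => ?_) v.2 hvs
      (fun j hj => hmin j hj v hvZ hvs) hvQ
    · simpa using this
    · obtain ⟨h1, h2⟩ := hPQ ⟨y, hy⟩ hyQ
      rw [dif_pos hy, hfc.2 a rfl _ h1, h2]
  refine ⟨Z ∩ X.chart i '' {v | eval v.1 (s * D^[k] Q) ≠ 0},
    isDenseOpenIn_inter hZ (isOpen_chart_image i _)
      ⟨_, hv₀Z, v₀, by simpa using ⟨hv₀s, hv₀Q⟩, rfl⟩, ?_⟩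
  rintro _ ⟨-, v, hv, rfl⟩
  -- The factor s restricts the fraction to where the g cut out the model.
  refine ⟨i, v, rfl, s * D^[k] P, s * D^[k] Q, hv, fun w hw hwq => ?_⟩
  rw [map_mul] at hwq
  have hws := left_ne_zero_of_mul hwq
  have hwQ := right_ne_zero_of_mul hwq
  rw [map_mul, map_mul, mul_div_mul_left _ _ hws, eq_div_iff hwQ]
  exact key w hw.1 hws hwQ

end RealAlgebraicVariety

end

theorem mainTheorem4 (X : RealAlgebraicVariety) :
    (∀ (Z : Set X.carrier), X.IsIrreducibleSubvariety Z → ¬ Z ⊆ X.singularLocus →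
      ∀ (f : X.RationalFunction) (fc : X.carrier → ℝ),
        RealAlgebraicVariety.IsContinuousExtension f fc →
          ∃ Z₀ : Set X.carrier, X.IsDenseOpenIn Z₀ Z ∧ X.IsRegularOn fc Z₀) ∧
    (X.IsSmooth →
      ∀ (f : X.RationalFunction) (fc : X.carrier → ℝ),
        RealAlgebraicVariety.IsContinuousExtension f fc → X.IsHereditarilyRational fc) := by
  refine ⟨fun Z hZ hsing f fc hfc =>
    RealAlgebraicVariety.exists_isDenseOpenIn_isRegularOn hZ hsing hfc,
    fun hX f fc hfc => ⟨hfc.1, fun Z hZ =>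
      RealAlgebraicVariety.exists_isDenseOpenIn_isRegularOn hZ ?_ hfc⟩⟩
  rw [show X.singularLocus = ∅ from hX, Set.subset_empty_iff]
  exact hZ.2.1.ne_empty
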